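/- Fix a number $m\ge 1$ of job classes and write $\mathcal I=\{1,\dots,m\}$. For each $n\in\mathbb N$ consider a system with $n$ servers in which class-$i$ jobs arrive according to a Poisson process of rate $\lambda_i^n$, have exponential service times of rate $\mu_i^n$ and exponential patience times of rate $\gamma_i^n$, all independent. Assume the Halfin--Whitt regime: as $n\to\infty$, for all $i\in\mathcal I$, $$\frac{\lambda_i^n}{n}\to\lambda_i>0,\quad \mu_i^n\to\mu_i>0,\quad \gamma_i^n\to\gamma_i\ge 0,\quad \frac{\lambda_i^n-n\lambda_i}{\sqrt n}\to\hat\lambda_i\in\mathbb R,\quad \sqrt n(\mu_i^n-\mu_i)\to\hat\mu_i\in\mathbb R,\quad \sum_{i=1}^m\frac{\lambda_i}{\mu_i}=1 .$$ For $x\in\mathbb Z_+^m$ (numbers of jobs present) let $\mathcal Z^n(x)=\{z\in\mathbb Z_+^m : z_i\le x_i,\ \|z\|_1=n\wedge\|x\|_1\}$ be the set of work-conserving allocations ($z_i$ jobs of class $i$ are in service). A work-conserving stationary Markov policy is a map $z:\mathbb Z_+^m\to\mathbb Z_+^m$ with $z(x)\in\mathcal Z^n(x)$ for all $x$; under it,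 the job counts form a continuous-time Markov chain $X^n$ on $\mathbb Z_+^m$ whose generator is $\mathcal A^n_{z(x)}$ at $x$, where $$\mathcal A^n_z f(x)=\sum_i\lambda_i^n\bigl(f(x+e_i)-f(x)\bigr)+\sum_i\bigl(\mu_i^nz_i+\gamma_i^n(x_i-z_i)\bigr)\bigl(f(x-e_i)-f(x)\bigr).$$ Let $$\varrho^n=\sqrt n\Bigl(1-\sum_i\frac{\lambda_i^n}{n\mu_i^n}\Bigr),\qquad \hat x^n_i(x)=\frac1{\sqrt n}\Bigl(x_i-\frac{\lambda_i^n}{\mu_i^n}\Bigr)-\frac{\varrho^n}{m},$$ let $\hat X^n=\hat x^n(X^n)$ be the diffusion-scaled process, with state space $\mathscr X^n=\hat x^n(\mathbb Z_+^m)$, and let $\hat{\mathcal A}^n_zV(\hat x^n(x))=\mathcal A^n_z(V\circ\hat x^n)(x)$; for $\hat x=\hat x^n(x)$ write $\mathcal Z^n(\hat x)=\mathcal Z^n(x)$. Let $\psi(t)=-\tfrac12$ for $t\le-1$, $\psi(t)=(t+1)^3-\tfrac12(t+1)^4-\tfrac12$ for $-1\le t\le0$, $\psi(t)=t$ for $t\ge0$,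 and $$\Psi^n(y)=\sum_i\frac{\psi(y_i)}{\mu^n_i},\qquad \beta_i^n=\frac{\gamma_i^n}{\mu_i^n},\qquad \theta^n=1\wedge\frac{(1-\min_i\beta_i^n)\vee\frac12}{\max_i\beta_i^n},\qquad \breve V^n_\eta(y)=\exp\bigl(\eta\theta^n\Psi^n(-y)+\eta\Psi^n(y)\bigr).$$ **Theorem.** Suppose that $\liminf_{n\to\infty}\gamma_i^n>0$ for all $i\in\mathcal I$. 1. For every $\eta>0$ there are positive constants $\kappa_0(\eta)$ and $\kappa_1(\eta)$, not depending on $n$, such that for all sufficiently large $n$ $$\hat{\mathcal A}^n_z\breve V^n_\eta(\hat x)\le\kappa_0(\eta)-\kappa_1(\eta)\,\|\hat x\|_1\,\breve V^n_\eta(\hat x)\qquad\text{for all }\hat x\in\mathscr X^n\text{ and }z\in\mathcal Z^n(\hat x).$$ 2. For all sufficiently large $n$ and every work-conserving stationary Markov policy, the process $\hat X^n$ has a unique stationary distribution, and $\hat x\mapsto\exp(\eta\|\hat x\|_1)$ is integrable under it for every $\eta>0$. -/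

import Mathlib

open Filter Topology MeasureTheory
open scoped ENNReal

noncomputable section

namespace ManyServer

/-! ### Continuous-time Markov chains on a countable state space -/

section Chain

variable {S : Type*} [DecidableEq S]

/-- Total jump rate out of `x`, for jump rates `q x y` from `x` to `y` (with `q x x = 0`). -/
def exitRate (q : S → S → ℝ≥0∞) (x : S) : ℝ≥0∞ := ∑' y, q x y

/-- `transitionUpTo q k t x y` is the probability that the chain with jump rates `q`, started at
`x`, is at `y` at time `t` and has made at most `k` jumps by then (condition on the time `s` and
the target `w` of the first jump). -/
def transitionUpTo (q : S → S → ℝ≥0∞) : ℕ → ℝ → S → S → ℝ≥0∞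
  | 0, t, x, y =>
      if x = y then ENNReal.ofReal (Real.exp (-(exitRate q x).toReal * t)) else 0
  | k + 1, t, x, y =>
      (if x = y then ENNReal.ofReal (Real.exp (-(exitRate q x).toReal * t)) else 0) +
        ∫⁻ s in Set.Icc 0 t, ENNReal.ofReal (Real.exp (-(exitRate q x).toReal * s)) *
          ∑' w, q x w * transitionUpTo q k (t - s) w y

/-- The transition function `P_t(x, y)` of the continuous-time Markov chain with jump rates `q`
(Feller's construction: the minimal nonnegative solution of the backward equations). -/
def transitionProb (q : S → S → ℝ≥0∞) (t : ℝ) (x y : S) : ℝ≥0∞ :=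
  ⨆ k, transitionUpTo q k t x y

/-- `π` is a stationary (probability) distribution of the chain with jump rates `q`:
`π P_t = π` for all `t ≥ 0`. -/
def IsStationaryDistribution [MeasurableSpace S] (q : S → S → ℝ≥0∞) (π : Measure S) : Prop :=
  IsProbabilityMeasure π ∧
    ∀ t : ℝ, 0 ≤ t → ∀ y : S, ∫⁻ x, transitionProb q t x y ∂π = π {y}

end Chain

/-! ### The multiclass many-server queue with Poisson arrivals -/

/-- Arrival rates `lam i`, service rates `mu i` and abandonment rates `gam i` of the classes. -/
structure Rates (m : ℕ) where
  lam : Fin m → ℝ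
  mu : Fin m → ℝ
  gam : Fin m → ℝ

/-- The Halfin--Whitt regime for the sequence `r n` of rates of the `n`-server systems. -/
structure HalfinWhitt {m : ℕ} (r : ℕ → Rates m)
    (lam mu gam lamHat muHat : Fin m → ℝ) : Prop where
  lam_pos : ∀ i, 0 < lam i
  mu_pos : ∀ i, 0 < mu i
  gam_nonneg : ∀ i, 0 ≤ gam i
  tendsto_lam : ∀ i, Tendsto (fun n : ℕ => (r n).lam i / n) atTop (𝓝 (lam i))
  tendsto_mu : ∀ i, Tendsto (fun n : ℕ => (r n).mu i) atTop (𝓝 (mu i))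
  tendsto_gam : ∀ i, Tendsto (fun n : ℕ => (r n).gam i) atTop (𝓝 (gam i))
  tendsto_lamHat : ∀ i,
    Tendsto (fun n : ℕ => ((r n).lam i - n * lam i) / √(n : ℝ)) atTop (𝓝 (lamHat i))
  tendsto_muHat : ∀ i,
    Tendsto (fun n : ℕ => √(n : ℝ) * ((r n).mu i - mu i)) atTop (𝓝 (muHat i))
  sum_load : ∑ i, lam i / mu i = 1

variable {m : ℕ}

/-- The work-conserving allocations `z` of `n` servers when `x i` jobs of class `i` are present:
`z i` is the number of class-`i` jobs in service. -/
def allocations (n : ℕ) (x : Fin m → ℕ) : Set (Fin m → ℕ) :=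
  {z | (∀ i, z i ≤ x i) ∧ ∑ i, z i = min n (∑ i, x i)}

/-- `z` is a work-conserving stationary Markov policy for the `n`-server system. -/
def IsWorkConservingPolicy (n : ℕ) (z : (Fin m → ℕ) → (Fin m → ℕ)) : Prop :=
  ∀ x, z x ∈ allocations n x

namespace Rates

/-- The rate `μ_i z_i + γ_i q_i`, `q_i = x_i - z_i`, at which class-`i` jobs leave the system. -/
def departureRate (r : Rates m) (x z : Fin m → ℕ) (i : Fin m) : ℝ :=
  r.mu i * z i + r.gam i * ((x i : ℝ) - z i)

/-- Jump rates of the Markov process of job counts under the stationary Markov policy `z`. -/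
def jumpRate (r : Rates m) (z : (Fin m → ℕ) → (Fin m → ℕ)) (x y : Fin m → ℕ) : ℝ≥0∞ :=
  (∑ i, if y = x + Pi.single i 1 then ENNReal.ofReal (r.lam i) else 0) +
    ∑ i, if x = y + Pi.single i 1 then ENNReal.ofReal (r.departureRate x (z x) i) else 0

/-- The generator of the process of job counts, at the state `x` and the allocation `z`. -/
def generator (r : Rates m) (z : Fin m → ℕ) (f : (Fin m → ℝ) → ℝ) (x : Fin m → ℕ) : ℝ :=
  (∑ i, r.lam i * (f ((fun j => (x j : ℝ)) + Pi.single i 1) - f (fun j => (x j : ℝ)))) +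
    ∑ i, r.departureRate x z i *
      (f ((fun j => (x j : ℝ)) - Pi.single i 1) - f (fun j => (x j : ℝ)))

/-- The spare capacity `ϱⁿ = √n (1 - ∑ λᵢⁿ / (n μᵢⁿ))`. -/
def spareCapacity (r : Rates m) (n : ℕ) : ℝ :=
  √(n : ℝ) * (1 - ∑ i, r.lam i / (n * r.mu i))

/-- The diffusion scaling `x ↦ x̂ⁿ(x)`. -/
def scale (r : Rates m) (n : ℕ) (x : Fin m → ℝ) : Fin m → ℝ :=
  fun i => (x i - r.lam i / r.mu i) / √(n : ℝ) - r.spareCapacity n / m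

/-- The diffusion-scaled state corresponding to the job counts `x`. -/
def scaledState (r : Rates m) (n : ℕ) (x : Fin m → ℕ) : Fin m → ℝ :=
  r.scale n (fun i => (x i : ℝ))

/-- The generator `Âⁿ_z` of the diffusion-scaled process: `(Âⁿ_z V)(x̂ⁿ(x)) = Aⁿ_z (V ∘ x̂ⁿ) (x)`.
The scaled state `x̂` is represented by the job counts `x`. -/
def scaledGenerator (r : Rates m) (n : ℕ) (z : Fin m → ℕ) (V : (Fin m → ℝ) → ℝ)
    (x : Fin m → ℕ) : ℝ :=
  r.generator z (fun y => V (r.scale n y)) x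

/-- `β_i = γ_i / μ_i`. -/
def beta (r : Rates m) (i : Fin m) : ℝ := r.gam i / r.mu i

/-- `θ = 1 ∧ ((1 - β_min) ∨ 1/2) / β_max`. -/
def theta (r : Rates m) : ℝ :=
  min 1 (max (1 - ⨅ i, r.beta i) (1 / 2) / ⨆ i, r.beta i)

end Rates

/-- The fixed convex `C²` function that is constant on `(-∞, -1]` and the identity on `[0, ∞)`. -/
def psi (t : ℝ) : ℝ :=
  if t ≤ -1 then -1 / 2
  else if t ≤ 0 then (t + 1) ^ 3 - (t + 1) ^ 4 / 2 - 1 / 2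
  else t

namespace Rates

/-- `Ψ(x) = ∑ ψ(x_i) / μ_i`. -/
def Psi (r : Rates m) (x : Fin m → ℝ) : ℝ := ∑ i, psi (x i) / r.mu i

/-- The Lyapunov function `exp (η θ Ψ(-x) + η Ψ(x))`. -/
def lyapunov (r : Rates m) (η : ℝ) (x : Fin m → ℝ) : ℝ :=
  Real.exp (η * r.theta * r.Psi (-x) + η * r.Psi x)

end Rates

/-- The norm `‖x‖₁ = ∑ |x_i|`. -/
def l1norm (x : Fin m → ℝ) : ℝ := ∑ i, |x i|

end ManyServer

end

namespace ManyServer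

/-! ### Backward recursion of the minimal chain: supersolutions and honesty -/

section Backward

/-! Drift bound. The exponent of the Lyapunov function is a sum over classes, so a jump of size ε =
1/√n in class i changes one factor, and a second-order expansion applies (`exp_sub_one_le`). The
weight 1/μ_i makes the first-order term η · slope · (−(y_i + e) + (1 − β_i) q_i), with q the scaled
queue and e the spare capacity divided by m. Work conservation and the centring give Σ q_i = (Σ
y_i)⁺ ≤ Σ y_i⁺, whatever the policy. The slope lies in [−θ, 1], and θ is tuned so that slope · (1 −
β_i) ≤ M for some M < 1 bounded away from 1 (`Rates.Bounded.theta_spec`). Hence the queue term costs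
at most M Σ y_i⁺ and a multiple of −‖y‖₁ survives (`sum_slope_mul_le`). The second-order term is
O(1) + O(ε)‖y‖₁ and is absorbed for large n. `HalfinWhitt.exists_bounded` makes all constants
independent of n.

Stationarity. Here n is fixed, and crude functions of the total number N of jobs suffice: arrivals
have constant total rate, while departures have rate at least cN under every policy. An exponential
weight 2^N rules out explosion. A linear function gives Foster's criterion for the jump chain;
dividing its invariant measure by the exit rates solves the balance equations. Such a solution is
subinvariant for the minimal transition function by the forward recursion, and honesty upgrades this
to invariance. Uniqueness follows from strict positivity of P_1. The drift of exp(aN) bounds every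
exponential moment of N, and ‖x̂‖₁ ≤ N/√n + const. -/

theorem setLIntegral_Icc_eq_lconvolution (F G : ℝ → ℝ≥0∞) (t : ℝ) :
    ∫⁻ s in Set.Icc 0 t, F s * G (t - s) =
      ((Set.Ici 0).indicator F ⋆ₗ (Set.Ici 0).indicator G) t := by
  rw [lconvolution_def, ← lintegral_indicator measurableSet_Icc]
  refine lintegral_congr fun s => ?_
  by_cases h0 : 0 ≤ s <;> by_cases h1 : s ≤ t <;>
    simp [Set.indicator, h0, h1, sub_eq_neg_add]

theorem measurable_setLIntegral_Icc {F G : ℝ → ℝ≥0∞} (hF : Measurable F) (hG : Measurable G) :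
    Measurable fun t => ∫⁻ s in Set.Icc 0 t, F s * G (t - s) := by
  simp_rw [setLIntegral_Icc_eq_lconvolution]
  exact measurable_lconvolution _ (hF.indicator measurableSet_Ici) (hG.indicator measurableSet_Ici)

/-- The holding time at a state with exit rate a either outlasts t or ends within [0, t]. An
infinite a is read as rate 0 by `toReal`. -/
theorem exp_add_mul_setLIntegral_exp (a : ℝ≥0∞) {t : ℝ} (ht : 0 ≤ t) :
    ENNReal.ofReal (Real.exp (-a.toReal * t)) + ENNReal.ofReal a.toReal *
      ∫⁻ s in Set.Icc 0 t, ENNReal.ofReal (Real.exp (-a.toReal * s)) = 1 := by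
  have hd : ∀ s, HasDerivAt (fun s => -Real.exp (-a.toReal * s))
      (a.toReal * Real.exp (-a.toReal * s)) s := fun s =>
    (((hasDerivAt_id s).const_mul (-a.toReal)).exp).neg.congr_deriv (by simp [mul_comm])
  have hc : Continuous fun s => a.toReal * Real.exp (-a.toReal * s) := by fun_prop
  have hi := intervalIntegral.integral_eq_sub_of_hasDerivAt (a := 0) (b := t)
    (fun s _ => hd s) (hc.intervalIntegrable _ _)
  rw [← lintegral_const_mul _ (by fun_prop)]
  simp_rw [← ENNReal.ofReal_mul ENNReal.toReal_nonneg]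
  rw [← ofReal_integral_eq_lintegral_ofReal hc.integrableOn_Icc
    (ae_of_all _ fun s => by positivity), integral_Icc_eq_integral_Ioc,
    ← intervalIntegral.integral_of_le ht, hi, ← ENNReal.ofReal_add (Real.exp_pos _).le]
  · simp
  · simp only [mul_zero, Real.exp_zero, sub_neg_eq_add, le_neg_add_iff_add_le, add_zero,
      Real.exp_le_one_iff]
    nlinarith [ENNReal.toReal_nonneg (a := a)]

variable {S : Type*} (q : S → S → ℝ≥0∞)

/-- Duhamel estimate for a supersolution `W` of the backward equation. -/
theorem setLIntegral_exp_mul_le (ρ : ℝ) (hρ : 0 ≤ ρ) {W W' : ℝ → S → ℝ} (x : S)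
    (hW : ∀ u, HasDerivAt (fun v => W v x) (W' u x) u) (hW' : Continuous fun u => W' u x)
    (hnn : ∀ u, 0 ≤ u → 0 ≤ (exitRate q x).toReal * W u x + W' u x)
    (hsup : ∀ u, 0 ≤ u → ∑' w, q x w * ENNReal.ofReal (W u w) ≤
      ENNReal.ofReal (ρ * ((exitRate q x).toReal * W u x + W' u x))) {t : ℝ} (ht : 0 ≤ t) :
    ∫⁻ s in Set.Icc 0 t, ENNReal.ofReal (Real.exp (-(exitRate q x).toReal * s)) *
        ∑' w, q x w * ENNReal.ofReal (W (t - s) w) ≤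
      ENNReal.ofReal (ρ * (W t x - Real.exp (-(exitRate q x).toReal * t) * W 0 x)) := by
  set Q := (exitRate q x).toReal with hQ
  have hcW : Continuous fun v => W v x := continuous_iff_continuousAt.2 fun u => (hW u).continuousAt
  -- Once `hsup` is applied, the integrand is an exact derivative, that of s ↦ −ρ e^(−Qs) W(t − s,
  -- x), so only boundary terms remain.
  set f : ℝ → ℝ := fun s => Real.exp (-Q * s) * (ρ * (Q * W (t - s) x + W' (t - s) x)) with hf
  have hfc : Continuous f := by
    have h1 : Continuous fun s => W (t - s) x := hcW.comp (continuous_const.sub continuous_id)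
    have h2 : Continuous fun s => W' (t - s) x := hW'.comp (continuous_const.sub continuous_id)
    fun_prop
  have hF : ∀ s, HasDerivAt (fun s => -(ρ * (Real.exp (-Q * s) * W (t - s) x))) (f s) s := by
    intro s
    have h1 : HasDerivAt (fun s => Real.exp (-Q * s)) (Real.exp (-Q * s) * (-Q * 1)) s :=
      ((hasDerivAt_id s).const_mul (-Q)).exp
    have h2 : HasDerivAt (fun s => W (t - s) x) (W' (t - s) x * -1) s :=
      (hW (t - s)).comp s ((hasDerivAt_id s).const_sub t)
    exact ((h1.mul h2).const_mul ρ).neg.congr_deriv (by simp only [hf]; ring)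
  have hint : ∫ s in (0)..t, f s = ρ * (W t x - Real.exp (-Q * t) * W 0 x) := by
    rw [intervalIntegral.integral_eq_sub_of_hasDerivAt (fun s _ => hF s)
      (hfc.intervalIntegrable _ _)]
    simp
    ring
  calc _ ≤ ∫⁻ s in Set.Icc 0 t, ENNReal.ofReal (f s) := by
        refine setLIntegral_mono' measurableSet_Icc fun s hs => ?_
        rw [hf, ENNReal.ofReal_mul (Real.exp_pos _).le]
        gcongr
        exact hsup _ (sub_nonneg.2 hs.2)
    _ = ENNReal.ofReal (∫ s in Set.Icc 0 t, f s) := by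
        rw [ofReal_integral_eq_lintegral_ofReal (hfc.integrableOn_Icc)]
        refine (ae_restrict_iff' measurableSet_Icc).2 (ae_of_all _ fun s hs => ?_)
        exact mul_nonneg (Real.exp_pos _).le (mul_nonneg hρ (hnn _ (sub_nonneg.2 hs.2)))
    _ = _ := by
        rw [integral_Icc_eq_integral_Ioc, ← intervalIntegral.integral_of_le ht, hint]

variable [DecidableEq S]

theorem measurable_transitionUpTo [Countable S] (k : ℕ) (x y : S) :
    Measurable fun t => transitionUpTo q k t x y := by
  induction k generalizing x with
  | zero =>
    simp only [transitionUpTo]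
    split_ifs <;> fun_prop
  | succ k ih =>
    simp only [transitionUpTo]
    refine Measurable.add (by split_ifs <;> fun_prop) ?_
    exact measurable_setLIntegral_Icc (F := fun s => ENNReal.ofReal
      (Real.exp (-(exitRate q x).toReal * s)))
      (G := fun u => ∑' w, q x w * transitionUpTo q k u w y) (by fun_prop)
      (Measurable.tsum fun w => (ih w).const_mul _)

theorem monotone_transitionUpTo (t : ℝ) (x y : S) :
    Monotone fun k => transitionUpTo q k t x y := by
  refine monotone_nat_of_le_succ fun k => ?_
  induction k generalizing t x with
  | zero => simp only [transitionUpTo]; exact le_self_add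
  | succ k ih =>
    rw [transitionUpTo, transitionUpTo]
    gcongr with s w
    exact ih _ _

/-- Backward recursion for the expectation of `g` on the event of at most `k + 1` jumps. -/
theorem tsum_transitionUpTo_succ [Countable S] (k : ℕ) (t : ℝ) (x : S) (g : S → ℝ≥0∞) :
    ∑' y, transitionUpTo q (k + 1) t x y * g y =
      ENNReal.ofReal (Real.exp (-(exitRate q x).toReal * t)) * g x +
        ∫⁻ s in Set.Icc 0 t, ENNReal.ofReal (Real.exp (-(exitRate q x).toReal * s)) *
          ∑' w, q x w * ∑' y, transitionUpTo q k (t - s) w y * g y := by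
  have hm : ∀ y, Measurable fun s => ENNReal.ofReal (Real.exp (-(exitRate q x).toReal * s)) *
      ∑' w, q x w * transitionUpTo q k (t - s) w y := fun y => by
    refine Measurable.mul (by fun_prop) (Measurable.tsum fun w => ?_)
    exact ((measurable_transitionUpTo q k w y).comp (measurable_const.sub measurable_id)).const_mul _
  simp_rw [transitionUpTo, add_mul]
  rw [ENNReal.tsum_add]
  congr 1
  · rw [tsum_eq_single x (fun y hy => by simp [hy.symm])]
    simp
  · simp_rw [← lintegral_mul_const _ (hm _)]
    rw [← lintegral_tsum fun y => ((hm y).mul_const _).aemeasurable]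
    refine lintegral_congr fun s => ?_
    simp_rw [mul_assoc, ENNReal.tsum_mul_left]
    congr 1
    simp_rw [← ENNReal.tsum_mul_left, ← ENNReal.tsum_mul_right]
    rw [ENNReal.tsum_comm]
    simp_rw [mul_assoc]

theorem tsum_transitionUpTo_zero (t : ℝ) (x : S) (g : S → ℝ≥0∞) :
    ∑' y, transitionUpTo q 0 t x y * g y =
      ENNReal.ofReal (Real.exp (-(exitRate q x).toReal * t)) * g x := by
  simp_rw [transitionUpTo]
  rw [tsum_eq_single x (fun y hy => by simp [hy.symm])]
  simp

theorem tsum_transitionProb (t : ℝ) (x : S) (g : S → ℝ≥0∞) :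
    ∑' y, transitionProb q t x y * g y = ⨆ k, ∑' y, transitionUpTo q k t x y * g y := by
  simp_rw [transitionProb, ENNReal.iSup_mul]
  simp_rw [ENNReal.tsum_eq_iSup_sum]
  rw [iSup_comm]
  congr 1; ext s
  rw [ENNReal.finsetSum_iSup_of_monotone]
  intro y a b hab
  have := monotone_transitionUpTo q t x y hab
  dsimp only at this ⊢
  gcongr

/-- Dynkin-type bound: `P_t W₀ ≤ W_t` for a nonnegative supersolution `W` of the backward
equation. -/
theorem tsum_transitionProb_mul_le [Countable S] {W W' : ℝ → S → ℝ} (h0 : ∀ u, 0 ≤ u → ∀ x, 0 ≤ W u x)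
    (hW : ∀ u x, HasDerivAt (fun v => W v x) (W' u x) u) (hW' : ∀ x, Continuous fun u => W' u x)
    (hnn : ∀ u, 0 ≤ u → ∀ x, 0 ≤ (exitRate q x).toReal * W u x + W' u x)
    (hsup : ∀ u, 0 ≤ u → ∀ x, ∑' w, q x w * ENNReal.ofReal (W u w) ≤
      ENNReal.ofReal ((exitRate q x).toReal * W u x + W' u x)) {t : ℝ} (ht : 0 ≤ t) (x : S) :
    ∑' y, transitionProb q t x y * ENNReal.ofReal (W 0 y) ≤ ENNReal.ofReal (W t x) := by
  rw [tsum_transitionProb]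
  refine iSup_le fun k => ?_
  -- One step of the backward recursion applied to W stays below W; induction on the number of jumps
  -- then does the rest.
  have key : ∀ t, 0 ≤ t → ∀ x,
      ENNReal.ofReal (Real.exp (-(exitRate q x).toReal * t)) * ENNReal.ofReal (W 0 x) +
        ∫⁻ s in Set.Icc 0 t, ENNReal.ofReal (Real.exp (-(exitRate q x).toReal * s)) *
          ∑' w, q x w * ENNReal.ofReal (W (t - s) w) ≤ ENNReal.ofReal (W t x) := by
    intro t ht x
    have h1 := setLIntegral_exp_mul_le q 1 zero_le_one x (fun u => hW u x) (hW' x)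
      (fun u hu => hnn u hu x) (fun u hu => by rw [one_mul]; exact hsup u hu x) ht
    rw [one_mul] at h1
    rw [← ENNReal.ofReal_mul (Real.exp_pos _).le]
    -- e^(Qu) W(u, x) is nondecreasing by `hnn`. This keeps the Duhamel bound nonnegative, so that
    -- `ENNReal.ofReal` is additive on it.
    have h2 : Real.exp (-(exitRate q x).toReal * t) * W 0 x ≤ W t x := by
      have hmono : MonotoneOn (fun u => Real.exp ((exitRate q x).toReal * u) * W u x)
          (Set.Icc 0 t) := by
        have hd : ∀ u, HasDerivAt (fun u => Real.exp ((exitRate q x).toReal * u) * W u x)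
            (Real.exp ((exitRate q x).toReal * u) *
              ((exitRate q x).toReal * W u x + W' u x)) u := fun u => by
          have h1 : HasDerivAt (fun s => Real.exp ((exitRate q x).toReal * s))
              (Real.exp ((exitRate q x).toReal * u) * ((exitRate q x).toReal * 1)) u :=
            ((hasDerivAt_id u).const_mul _).exp
          exact (h1.mul (hW u x)).congr_deriv (by ring)
        refine monotoneOn_of_deriv_nonneg (convex_Icc 0 t)
          (fun u _ => (hd u).continuousAt.continuousWithinAt)
          (fun u _ => (hd u).differentiableAt.differentiableWithinAt) fun u hu => ?_
        rw [interior_Icc] at hu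
        rw [(hd u).deriv]
        exact mul_nonneg (Real.exp_pos _).le (hnn u hu.1.le x)
      have := hmono (Set.left_mem_Icc.2 ht) (Set.right_mem_Icc.2 ht) ht
      simp only [mul_zero, Real.exp_zero, one_mul] at this
      rw [neg_mul, Real.exp_neg, inv_mul_le_iff₀ (Real.exp_pos _)]
      exact this
    calc _ ≤ _ := add_le_add_right h1 _
      _ = _ := by
        rw [← ENNReal.ofReal_add (mul_nonneg (Real.exp_pos _).le (h0 0 le_rfl x))
          (sub_nonneg.2 h2)]
        congr 1; ring
  induction k generalizing t x with
  | zero =>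
    rw [tsum_transitionUpTo_zero]
    exact le_trans le_self_add (key t ht x)
  | succ k ih =>
    rw [tsum_transitionUpTo_succ]
    refine le_trans (add_le_add_right ?_ _) (key t ht x)
    refine setLIntegral_mono' measurableSet_Icc fun s hs => ?_
    gcongr with w
    exact ih (sub_nonneg.2 hs.2) w

/-- The constant 1 is a supersolution. -/
theorem tsum_transitionProb_le_one [Countable S] (hq : ∀ x, exitRate q x ≠ ∞) {t : ℝ} (ht : 0 ≤ t) (x : S) :
    ∑' y, transitionProb q t x y ≤ 1 := by
  have := tsum_transitionProb_mul_le q (W := fun _ _ => 1) (W' := fun _ _ => 0)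
    (fun _ _ _ => zero_le_one) (fun u x => hasDerivAt_const _ _) (fun _ => continuous_const)
    (fun u _ x => by positivity) (fun u _ x => by
      simp only [ENNReal.ofReal_one, mul_one, add_zero]
      rw [ENNReal.ofReal_toReal (hq x)]; rfl) ht x
  simpa using this

/-- The minimal chain is honest if some weight `W` bounds the growth of the jump chain
geometrically. -/
theorem tsum_transitionProb_eq_one [Countable S] (hq : ∀ x, exitRate q x ≠ ∞) {ρ : ℝ} (hρ0 : 0 ≤ ρ)
    (hρ1 : ρ < 1) {W W' : ℝ → S → ℝ} (h1 : ∀ u, 0 ≤ u → ∀ x, 1 ≤ W u x)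
    (hW : ∀ u x, HasDerivAt (fun v => W v x) (W' u x) u) (hW' : ∀ x, Continuous fun u => W' u x)
    (hnn : ∀ u, 0 ≤ u → ∀ x, 0 ≤ (exitRate q x).toReal * W u x + W' u x)
    (hsup : ∀ u, 0 ≤ u → ∀ x, ∑' w, q x w * ENNReal.ofReal (W u w) ≤
      ENNReal.ofReal (ρ * ((exitRate q x).toReal * W u x + W' u x))) {t : ℝ} (ht : 0 ≤ t) (x : S) :
    ∑' y, transitionProb q t x y = 1 := by
  -- The probability of more than k jumps by time t is at most ρ^k W(t, x): each jump gains a factor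
  -- ρ, and W ≥ 1 starts the induction.
  have key : ∀ k : ℕ, ∀ t, 0 ≤ t → ∀ x,
      1 ≤ ∑' y, transitionUpTo q k t x y * 1 + ENNReal.ofReal (ρ ^ k) * ENNReal.ofReal (W t x) := by
    intro k
    induction k with
    | zero =>
      intro t ht x
      refine le_trans ?_ le_add_self
      simpa using h1 t ht x
    | succ k ih =>
      intro t ht x
      rw [tsum_transitionUpTo_succ]
      have hone : (1 : ℝ≥0∞) ≤ ENNReal.ofReal (Real.exp (-(exitRate q x).toReal * t)) * 1 +
          ∫⁻ s in Set.Icc 0 t, ENNReal.ofReal (Real.exp (-(exitRate q x).toReal * s)) *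
            exitRate q x := by
        have he := exp_add_mul_setLIntegral_exp (exitRate q x) ht
        rw [ENNReal.ofReal_toReal (hq x)] at he
        rw [mul_one, lintegral_mul_const _ (by fun_prop), mul_comm _ (exitRate q x), he]
      have hW1 := setLIntegral_exp_mul_le q ρ hρ0 x (fun u => hW u x) (hW' x)
        (fun u hu => hnn u hu x) (fun u hu => hsup u hu x) ht
      have hW2 : ∫⁻ s in Set.Icc 0 t, ENNReal.ofReal (Real.exp (-(exitRate q x).toReal * s)) *
          ∑' w, q x w * ENNReal.ofReal (W (t - s) w) ≤ ENNReal.ofReal ρ * ENNReal.ofReal (W t x) := by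
        rw [← ENNReal.ofReal_mul hρ0]
        refine hW1.trans (ENNReal.ofReal_le_ofReal ?_)
        gcongr
        have := mul_nonneg (Real.exp_pos (-(exitRate q x).toReal * t)).le
          (zero_le_one.trans (h1 0 le_rfl x))
        linarith
      refine hone.trans ?_
      rw [add_assoc]
      gcongr
      calc _ ≤ ∫⁻ s in Set.Icc 0 t, (ENNReal.ofReal (Real.exp (-(exitRate q x).toReal * s)) *
              (∑' w, q x w * ∑' y, transitionUpTo q k (t - s) w y * 1) +
              ENNReal.ofReal (ρ ^ k) *
              (ENNReal.ofReal (Real.exp (-(exitRate q x).toReal * s)) *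
              ∑' w, q x w * ENNReal.ofReal (W (t - s) w))) := by
            refine setLIntegral_mono' measurableSet_Icc fun s hs => ?_
            rw [mul_left_comm, ← mul_add]
            gcongr
            rw [exitRate, ← ENNReal.tsum_mul_left, ← ENNReal.tsum_add]
            refine ENNReal.tsum_le_tsum fun w => ?_
            rw [mul_left_comm, ← mul_add]
            exact le_mul_of_one_le_right' (ih _ (sub_nonneg.2 hs.2) w)
        _ = _ := by
            rw [lintegral_add_left, lintegral_const_mul']
            · exact ENNReal.ofReal_ne_top
            · refine Measurable.mul (by fun_prop) (Measurable.tsum fun w => ?_)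
              refine (Measurable.tsum fun y => ?_).const_mul _
              exact ((measurable_transitionUpTo q k w y).comp
                (measurable_const.sub measurable_id)).mul_const _
        _ ≤ _ := by
            rw [pow_succ, ENNReal.ofReal_mul (pow_nonneg hρ0 k), mul_assoc]
            gcongr
  refine le_antisymm (tsum_transitionProb_le_one q hq ht x) ?_
  have h := tsum_transitionProb q t x (fun _ => 1)
  simp only [mul_one] at h
  have hlim : Tendsto (fun k : ℕ => (∑' y, transitionProb q t x y) +
      ENNReal.ofReal (ρ ^ k) * ENNReal.ofReal (W t x)) atTop
      (𝓝 (∑' y, transitionProb q t x y + ENNReal.ofReal 0 * ENNReal.ofReal (W t x))) := by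
    refine tendsto_const_nhds.add (ENNReal.Tendsto.mul_const ?_ (Or.inr ENNReal.ofReal_ne_top))
    exact ENNReal.tendsto_ofReal (tendsto_pow_atTop_nhds_zero_of_lt_one hρ0 hρ1)
  simp only [ENNReal.ofReal_zero, zero_mul, add_zero] at hlim
  refine ge_of_tendsto' hlim fun k => (key k t ht x).trans ?_
  simp only [mul_one]
  refine add_le_add_left ?_ _
  rw [h]
  exact le_iSup (fun k => ∑' y, transitionUpTo q k t x y) k

end Backward

/-! ### Forward recursion and subinvariance of solutions of the balance equations -/

section Forward

theorem lconvolution_tsum_right {ι : Type*} [Countable ι] {f : ℝ → ℝ≥0∞} (hf : Measurable f)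
    (c : ι → ℝ≥0∞) {g : ι → ℝ → ℝ≥0∞} (hg : ∀ i, Measurable (g i)) :
    (f ⋆ₗ fun t => ∑' i, c i * g i t) = fun t => ∑' i, c i * (f ⋆ₗ g i) t := by
  funext t
  have hm : ∀ i, Measurable fun s => f s * g i (-s + t) := fun i =>
    hf.mul ((hg i).comp (by fun_prop))
  simp_rw [lconvolution_def, ← ENNReal.tsum_mul_left]
  rw [lintegral_tsum fun i => ?_]
  · congr 1; funext i
    rw [← lintegral_const_mul _ (hm i)]
    simp_rw [mul_left_comm (f _)]
  · simp_rw [mul_left_comm (f _)]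
    exact ((hm i).const_mul _).aemeasurable

theorem lconvolution_tsum_left {ι : Type*} [Countable ι] {f : ℝ → ℝ≥0∞} (hf : Measurable f)
    (c : ι → ℝ≥0∞) {g : ι → ℝ → ℝ≥0∞} (hg : ∀ i, Measurable (g i)) :
    ((fun t => ∑' i, c i * g i t) ⋆ₗ f) = fun t => ∑' i, c i * (g i ⋆ₗ f) t := by
  rw [lconvolution_comm, lconvolution_tsum_right hf c hg]
  simp_rw [lconvolution_comm (f := f)]

theorem lconvolution_finsetSum_right {ι : Type*} (A : Finset ι) {f : ℝ → ℝ≥0∞}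
    (hf : Measurable f) {g : ι → ℝ → ℝ≥0∞} (hg : ∀ i, Measurable (g i)) (t : ℝ) :
    (f ⋆ₗ fun t => ∑ i ∈ A, g i t) t = ∑ i ∈ A, (f ⋆ₗ g i) t := by
  simp only [lconvolution_def, Finset.mul_sum]
  exact lintegral_finsetSum _ fun j _ => hf.mul ((hg j).comp (by fun_prop))

variable {S : Type*} (q : S → S → ℝ≥0∞)

/-- The survival function of the holding time at `x`, extended by `0` to negative times. -/
noncomputable def holding (x : S) : ℝ → ℝ≥0∞ :=
  (Set.Ici 0).indicator fun s => ENNReal.ofReal (Real.exp (-(exitRate q x).toReal * s))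

theorem measurable_holding (x : S) : Measurable (holding q x) :=
  Measurable.indicator (by fun_prop) measurableSet_Ici

variable [DecidableEq S]

/-- The probability of being at `y` at time `t` after exactly `k` jumps, starting from `x`. -/
noncomputable def transitionExactly : ℕ → S → S → ℝ → ℝ≥0∞
  | 0, x, y => if x = y then holding q x else 0
  | k + 1, x, y => fun t => ∑' w, q x w * (holding q x ⋆ₗ transitionExactly k w y) t

theorem measurable_transitionExactly [Countable S] (k : ℕ) (x y : S) :
    Measurable (transitionExactly q k x y) := by
  induction k generalizing x with
  | zero =>
    simp only [transitionExactly]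
    split_ifs
    exacts [measurable_holding q x, measurable_const]
  | succ k ih =>
    exact Measurable.tsum fun w =>
      (measurable_lconvolution _ (measurable_holding q x) (ih w)).const_mul _

theorem transitionExactly_of_neg (k : ℕ) (x y : S) {t : ℝ} (ht : t < 0) :
    transitionExactly q k x y t = 0 := by
  induction k generalizing x t with
  | zero =>
    simp only [transitionExactly]
    split_ifs <;> simp [holding, ht]
  | succ k ih =>
    simp only [transitionExactly, lconvolution_def, ENNReal.tsum_eq_zero]
    intro w
    refine mul_eq_zero_of_right _ ?_
    rw [lintegral_eq_zero_of_ae_eq_zero]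
    refine ae_of_all _ fun s => ?_
    by_cases hs : 0 ≤ s
    · simp [ih w (t := -s + t) (by linarith)]
    · simp [holding, hs]

/-- Links the truncated recursion to exact jump counts, for which first-jump and last-jump
decompositions are both iterated convolutions. -/
theorem indicator_transitionUpTo [Countable S] (k : ℕ) (x y : S) :
    (Set.Ici 0).indicator (fun t => transitionUpTo q k t x y) =
      fun t => ∑ j ∈ Finset.range (k + 1), transitionExactly q j x y t := by
  induction k generalizing x with
  | zero =>
    funext t
    simp only [zero_add, Finset.range_one, Finset.sum_singleton, transitionUpTo,
      transitionExactly, holding]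
    split_ifs <;> by_cases h : 0 ≤ t <;> simp [h, Set.indicator]
  | succ k ih =>
    funext t
    by_cases ht : 0 ≤ t
    · rw [Set.indicator_of_mem (Set.mem_Ici.2 ht), transitionUpTo, Finset.sum_range_succ', add_comm]
      congr 1
      · rw [setLIntegral_Icc_eq_lconvolution
          (fun s => ENNReal.ofReal (Real.exp (-(exitRate q x).toReal * s)))
          (fun u => ∑' w, q x w * transitionUpTo q k u w y)]
        have h1 : (Set.Ici 0).indicator (fun u => ∑' w, q x w * transitionUpTo q k u w y) =
            fun u => ∑' w, q x w *
              (∑ j ∈ Finset.range (k + 1), transitionExactly q j w y u) := by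
          funext u
          have h2 := fun w => congrFun (ih w) u
          simp_rw [← h2]
          by_cases hu : 0 ≤ u <;> simp [hu, Set.indicator]
        rw [h1]
        change (holding q x ⋆ₗ _) t = _
        rw [lconvolution_tsum_right (measurable_holding q x) _ (fun w =>
          Finset.measurable_sum _ fun j _ => measurable_transitionExactly q j w y)]
        simp only [transitionExactly]
        rw [← Summable.tsum_finsetSum (fun _ _ => ENNReal.summable)]
        congr 1; funext w
        rw [← Finset.mul_sum]
        congr 1
        rw [lconvolution_finsetSum_right _ (measurable_holding q x)
          (fun j => measurable_transitionExactly q j w y)]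
      · simp only [transitionExactly, holding]
        split_ifs <;> simp [ht]
    · simp [ht, transitionExactly_of_neg q _ x y (not_le.1 ht)]

/-- Kolmogorov's forward recursion, conditioning on the last jump. -/
theorem transitionExactly_succ_forward [Countable S] (k : ℕ) (x y : S) :
    transitionExactly q (k + 1) x y =
      fun t => ∑' v, q v y * (transitionExactly q k x v ⋆ₗ holding q y) t := by
  induction k generalizing x with
  | zero =>
    funext t
    simp only [transitionExactly]
    rw [tsum_eq_single y (fun w hw => by simp [hw]), tsum_eq_single x (fun w hw => by simp [hw.symm])]
    simp
  | succ k ih =>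
    funext t
    rw [transitionExactly]
    simp_rw [ih]
    -- Removing the first jump and removing the last one commute, by associativity of convolution
    -- and Tonelli.
    have h1 : ∀ w, (holding q x ⋆ₗ fun t => ∑' v, q v y *
        (transitionExactly q k w v ⋆ₗ holding q y) t) t =
        ∑' v, q v y * (holding q x ⋆ₗ transitionExactly q k w v ⋆ₗ holding q y) t := fun w => by
      rw [lconvolution_tsum_right (measurable_holding q x) _ (fun v => measurable_lconvolution _
        (measurable_transitionExactly q k w v) (measurable_holding q y))]
    have h2 : ∀ v, (transitionExactly q (k + 1) x v ⋆ₗ holding q y) t =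
        ∑' w, q x w * (holding q x ⋆ₗ transitionExactly q k w v ⋆ₗ holding q y) t := fun v => by
      rw [transitionExactly, lconvolution_tsum_left (measurable_holding q y) _ (fun w =>
        measurable_lconvolution _ (measurable_holding q x) (measurable_transitionExactly q k w v))]
      simp_rw [lconvolution_assoc (measurable_holding q x) (measurable_transitionExactly q k _ v)
        (measurable_holding q y)]
    simp_rw [h1, h2, ← ENNReal.tsum_mul_left]
    rw [ENNReal.tsum_comm]
    simp_rw [mul_left_comm (q _ y)]

theorem sum_transitionExactly_forward [Countable S] (k : ℕ) (x y : S) (t : ℝ) :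
    ∑ j ∈ Finset.range (k + 2), transitionExactly q j x y t =
      ∑' v, q v y * ((fun s => ∑ j ∈ Finset.range (k + 1), transitionExactly q j x v s) ⋆ₗ
        holding q y) t + transitionExactly q 0 x y t := by
  rw [Finset.sum_range_succ']
  congr 1
  simp_rw [transitionExactly_succ_forward, lconvolution_comm (g := holding q y)]
  rw [← Summable.tsum_finsetSum (fun _ _ => ENNReal.summable)]
  congr 1; funext v
  rw [← Finset.mul_sum, lconvolution_finsetSum_right _ (measurable_holding q y)
    (fun j => measurable_transitionExactly q j x v)]

/-- A solution of the balance equations is subinvariant for the minimal transition function. -/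
theorem tsum_transitionProb_mul_le_of_balance [Countable S] (hq : ∀ x, exitRate q x ≠ ∞)
    {p : S → ℝ≥0∞} (hp : ∀ y, ∑' x, p x * q x y = p y * exitRate q y) {t : ℝ} (ht : 0 ≤ t)
    (y : S) : ∑' x, transitionProb q t x y * p x ≤ p y := by
  have h0 : ∀ t y, ∑' x, p x * transitionExactly q 0 x y t = p y * holding q y t := by
    intro t y
    rw [tsum_eq_single y (fun w hw => by simp [transitionExactly, hw])]
    simp [transitionExactly]
  -- Subinvariance is proved for at most k jumps, by induction on k through the last jump.
  have key : ∀ k : ℕ, ∀ t, ∀ y,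
      ∑' x, p x * ∑ j ∈ Finset.range (k + 1), transitionExactly q j x y t ≤ p y := by
    intro k
    induction k with
    | zero =>
      intro t y
      simp only [zero_add, Finset.range_one, Finset.sum_singleton]
      rw [h0]
      refine mul_le_of_le_one_right' ?_
      refine Set.indicator_le' (fun s hs => ?_) (g := fun _ => 1) (fun _ _ => zero_le) t
      simp only [ENNReal.ofReal_le_one, Real.exp_le_one_iff]
      nlinarith [ENNReal.toReal_nonneg (a := exitRate q y), Set.mem_Ici.1 hs]
    | succ k ih =>
      intro t y
      by_cases ht : 0 ≤ t
      swap
      · simp [transitionExactly_of_neg q _ _ y (not_le.1 ht)]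
      have hm : ∀ x v, Measurable fun s =>
          ∑ j ∈ Finset.range (k + 1), transitionExactly q j x v s := fun x v =>
        Finset.measurable_fun_sum _ fun j _ => measurable_transitionExactly q j x v
      have hconv : ∀ v, ((fun s => ∑' x, p x * ∑ j ∈ Finset.range (k + 1),
          transitionExactly q j x v s) ⋆ₗ holding q y) t ≤
          p v * ∫⁻ s in Set.Icc 0 t, ENNReal.ofReal (Real.exp (-(exitRate q y).toReal * s)) := by
        intro v
        rw [lconvolution_comm, lconvolution_def, ← lintegral_const_mul _ (by fun_prop),
          ← lintegral_indicator measurableSet_Icc]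
        refine lintegral_mono fun s => ?_
        by_cases hs : 0 ≤ s
        · by_cases hst : s ≤ t
          · rw [Set.indicator_of_mem (show s ∈ Set.Icc 0 t from ⟨hs, hst⟩), holding,
              Set.indicator_of_mem (Set.mem_Ici.2 hs), mul_comm (p v)]
            gcongr
            exact ih _ v
          · have : -s + t < 0 := by linarith
            simp [transitionExactly_of_neg q _ _ v this]
        · simp [holding, hs]
      simp_rw [sum_transitionExactly_forward, mul_add, ← ENNReal.tsum_mul_left]
      rw [ENNReal.tsum_add, h0, ENNReal.tsum_comm]
      simp_rw [mul_left_comm (p _), ENNReal.tsum_mul_left]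
      have hl := fun v => congrFun (lconvolution_tsum_left (measurable_holding q y) p
        (fun x => hm x v)) t
      simp_rw [← hl]
      calc _ ≤ ∑' v, q v y * (p v * ∫⁻ s in Set.Icc 0 t,
              ENNReal.ofReal (Real.exp (-(exitRate q y).toReal * s))) + p y * holding q y t := by
            gcongr with v
            exact hconv v
        -- The balance equation replaces the inflow into y by p(y) times the exit rate; the last
        -- holding period then accounts for exactly p(y).
        _ = p y := by
            simp_rw [← mul_assoc, ENNReal.tsum_mul_right, mul_comm (q _ y), hp]
            rw [holding, Set.indicator_of_mem (Set.mem_Ici.2 ht), mul_assoc, ← mul_add, add_comm]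
            have := exp_add_mul_setLIntegral_exp (exitRate q y) ht
            rw [ENNReal.ofReal_toReal (hq y)] at this
            rw [this, mul_one]
  simp_rw [mul_comm _ (p _), transitionProb, ENNReal.mul_iSup, ENNReal.tsum_eq_iSup_sum]
  refine iSup_le fun A => ?_
  rw [ENNReal.finsetSum_iSup_of_monotone]
  · refine iSup_le fun k => (ENNReal.sum_le_tsum A).trans ((le_of_eq ?_).trans (key k t y))
    congr 1; funext x
    rw [← congrFun (indicator_transitionUpTo q k x y) t, Set.indicator_of_mem (Set.mem_Ici.2 ht)]
  · intro x a b hab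
    have := monotone_transitionUpTo q t x y hab
    dsimp only at this ⊢
    gcongr

end Forward

/-! ### Uniqueness and moments of stationary distributions -/

section Stationary

/-- Upgrades subinvariance to invariance whenever finite total mass is conserved. -/
theorem eq_of_le_of_tsum_eq {S : Type*} {f g : S → ℝ≥0∞} (h : ∀ x, f x ≤ g x)
    (hs : ∑' x, f x = ∑' x, g x) (hf : ∑' x, f x ≠ ∞) : f = g := by
  by_contra hne
  obtain ⟨x, hx⟩ := Function.ne_iff.1 hne
  exact (ENNReal.tsum_lt_tsum hf h (lt_of_le_of_ne (h x) hx)).ne hs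

/-- A strictly positive stochastic matrix has at most one invariant probability vector. -/
theorem invariant_unique {S : Type*} {P : S → S → ℝ≥0∞} (hpos : ∀ x y, 0 < P x y)
    (hone : ∀ x, ∑' y, P x y = 1) {a b : S → ℝ≥0∞} (ha : ∑' x, a x = 1) (hb : ∑' x, b x = 1)
    (hPa : ∀ y, ∑' x, P x y * a x = a y) (hPb : ∀ y, ∑' x, P x y * b x = b y) : a = b := by
  have hmass : ∀ f : S → ℝ≥0∞, ∑' y, ∑' x, P x y * f x = ∑' x, f x := fun f => by
    rw [ENNReal.tsum_comm]
    simp_rw [ENNReal.tsum_mul_right, hone, one_mul]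
  -- The minimum is subinvariant, hence invariant by conservation of mass. Then a − c and b − c are
  -- invariant too; by strict positivity each vanishes everywhere or nowhere, and at every point one
  -- of them vanishes.
  set c : S → ℝ≥0∞ := fun x => min (a x) (b x) with hc
  have hca : ∀ x, c x ≤ a x := fun x => min_le_left _ _
  have hcb : ∀ x, c x ≤ b x := fun x => min_le_right _ _
  have hc1 : ∑' x, c x ≠ ∞ :=
    ne_top_of_le_ne_top ENNReal.one_ne_top (ha ▸ ENNReal.tsum_le_tsum hca)
  have hPc : (fun y => ∑' x, P x y * c x) = c := by
    refine eq_of_le_of_tsum_eq (fun y => le_min ?_ ?_) (hmass c) (by rw [hmass]; exact hc1)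
    · rw [← hPa y]; gcongr; exact hca _
    · rw [← hPb y]; gcongr; exact hcb _
  have hcfin : ∀ x, c x ≠ ∞ := ENNReal.ne_top_of_tsum_ne_top hc1
  have hdiff : ∀ f : S → ℝ≥0∞, (∀ y, ∑' x, P x y * f x = f y) → (∀ x, c x ≤ f x) →
      ∀ x, f x ≠ c x → ∀ y, f y ≠ c y := by
    intro f hPf hcf x hx y hy
    have h1 : ∑' x, P x y * (f x - c x) = 0 := by
      have h2 : ∑' x, P x y * (f x - c x) + ∑' x, P x y * c x = f y := by
        rw [← ENNReal.tsum_add, ← hPf y]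
        congr 1; funext x
        rw [← mul_add, tsub_add_cancel_of_le (hcf x)]
      rw [congrFun hPc y, hy] at h2
      exact (ENNReal.add_left_inj (hcfin y)).1 (h2.trans (zero_add _).symm)
    rw [ENNReal.tsum_eq_zero] at h1
    rcases mul_eq_zero.1 (h1 x) with h | h
    · exact (hpos x y).ne' h
    · exact hx (le_antisymm (tsub_eq_zero_iff_le.1 h) (hcf x))
  by_cases h : a = c
  · exact eq_of_le_of_tsum_eq (fun x => by rw [h]; exact hcb x) (ha.trans hb.symm)
      (ha ▸ ENNReal.one_ne_top)
  by_cases h' : b = c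
  · exact (eq_of_le_of_tsum_eq (fun x => by rw [h']; exact hca x) (hb.trans ha.symm)
      (hb ▸ ENNReal.one_ne_top)).symm
  obtain ⟨x, hx⟩ := Function.ne_iff.1 h
  obtain ⟨x', hx'⟩ := Function.ne_iff.1 h'
  rcases min_choice (a x) (b x) with h1 | h1
  · exact absurd h1.symm hx
  · exact absurd h1.symm (hdiff b hPb hcb x' hx' x)

variable {S : Type*} [DecidableEq S] (q : S → S → ℝ≥0∞)

/-- Induction along a path of positive rates: the first-jump integrand is nonzero on a set of
positive measure. -/
theorem transitionProb_pos [Countable S] {x y : S}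
    (h : Relation.ReflTransGen (fun x y => q x y ≠ 0) x y) {t : ℝ} (ht : 0 < t) :
    0 < transitionProb q t x y := by
  obtain ⟨k, hk⟩ : ∃ k, ∀ t, 0 < t → 0 < transitionUpTo q k t x y := by
    clear ht
    induction h using Relation.ReflTransGen.head_induction_on with
    | refl => exact ⟨0, fun t _ => by simp [transitionUpTo, Real.exp_pos]⟩
    | @head x w hxw _ ih =>
      obtain ⟨k, hk⟩ := ih
      refine ⟨k + 1, fun t ht => ?_⟩
      rw [transitionUpTo]
      refine lt_of_lt_of_le ?_ le_add_self
      have hm : Measurable fun s => ENNReal.ofReal (Real.exp (-(exitRate q x).toReal * s)) *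
          ∑' w, q x w * transitionUpTo q k (t - s) w y := by
        refine Measurable.mul (by fun_prop) (Measurable.tsum fun w => ?_)
        exact ((measurable_transitionUpTo q k w y).comp
          (measurable_const.sub measurable_id)).const_mul _
      rw [setLIntegral_pos_iff hm]
      -- The endpoint s = t is excluded because `hk` needs positive remaining time.
      have hsub : Set.Ico 0 t ⊆ (Function.support fun s =>
          ENNReal.ofReal (Real.exp (-(exitRate q x).toReal * s)) *
          ∑' w, q x w * transitionUpTo q k (t - s) w y) ∩ Set.Icc 0 t := by
        refine fun s hs => ⟨?_, Set.Ico_subset_Icc_self hs⟩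
        refine mul_ne_zero (by simp [Real.exp_pos]) fun h0 => ?_
        rw [ENNReal.tsum_eq_zero] at h0
        exact mul_ne_zero hxw (hk _ (sub_pos.2 hs.2)).ne' (h0 w)
      refine lt_of_lt_of_le ?_ (measure_mono hsub)
      simpa using ht
  exact (hk t ht).trans_le (le_iSup (fun k => transitionUpTo q k t x y) k)

variable {q}

theorem IsStationaryDistribution.tsum_eq [Countable S] [MeasurableSpace S]
    [MeasurableSingletonClass S] {π : Measure S} (h : IsStationaryDistribution q π) {t : ℝ}
    (ht : 0 ≤ t) (y : S) : ∑' x, transitionProb q t x y * π {x} = π {y} := by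
  rw [← h.2 t ht y, lintegral_countable']

theorem IsStationaryDistribution.tsum_eq_one [Countable S] [MeasurableSpace S]
    [MeasurableSingletonClass S] {π : Measure S} (h : IsStationaryDistribution q π) :
    ∑' x, π {x} = 1 := by
  have := h.1
  rw [← measure_univ (μ := π), ← lintegral_one, lintegral_countable']
  simp

theorem IsStationaryDistribution.unique [Countable S] [MeasurableSpace S]
    [MeasurableSingletonClass S]
    (hirr : ∀ x y, Relation.ReflTransGen (fun x y => q x y ≠ 0) x y)
    (hone : ∀ t, 0 ≤ t → ∀ x, ∑' y, transitionProb q t x y = 1) {π π' : Measure S}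
    (h : IsStationaryDistribution q π) (h' : IsStationaryDistribution q π') : π = π' := by
  have := invariant_unique (fun x y => transitionProb_pos q (hirr x y) one_pos)
    (hone 1 zero_le_one) h.tsum_eq_one h'.tsum_eq_one (h.tsum_eq zero_le_one)
    (h'.tsum_eq zero_le_one)
  exact Measure.ext_of_singleton fun x => congrFun this x

/-- Foster--Lyapunov moment bound: if `Q V ≤ c (K - V)` then `π V ≤ K`. -/
theorem IsStationaryDistribution.lintegral_le [Countable S] [MeasurableSpace S]
    [MeasurableSingletonClass S] (hq : ∀ x, exitRate q x ≠ ∞) {V : S → ℝ} (hV : ∀ x, 0 ≤ V x)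
    {c K : ℝ} (hc : 0 < c) (hK : 0 ≤ K)
    (hnn : ∀ x, 0 ≤ (exitRate q x).toReal * V x + c * (K - V x))
    (hdrift : ∀ x, ∑' w, q x w * ENNReal.ofReal (V w) ≤
      ENNReal.ofReal ((exitRate q x).toReal * V x + c * (K - V x)))
    {π : Measure S} (h : IsStationaryDistribution q π) :
    ∫⁻ x, ENNReal.ofReal (V x) ∂π ≤ ENNReal.ofReal K := by
  have hprob := h.1
  -- W solves W' = c (K − W) with initial value V, and the drift condition makes it a supersolution.
  set W : ℝ → S → ℝ := fun u x => Real.exp (-c * u) * V x + K * (1 - Real.exp (-c * u)) with hWdef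
  set W' : ℝ → S → ℝ := fun u x => Real.exp (-c * u) * (c * (K - V x)) with hWdef'
  have hexp : ∀ u : ℝ, 0 ≤ u → 0 ≤ 1 - Real.exp (-c * u) := fun u hu => by
    rw [sub_nonneg, Real.exp_le_one_iff]; nlinarith
  have hid : ∀ u x, (exitRate q x).toReal * W u x + W' u x =
      Real.exp (-c * u) * ((exitRate q x).toReal * V x + c * (K - V x)) +
        (exitRate q x).toReal * (K * (1 - Real.exp (-c * u))) := fun u x => by
    simp only [hWdef, hWdef']; ring
  have hbound : ∀ t, 0 ≤ t → ∀ x,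
      ∑' y, transitionProb q t x y * ENNReal.ofReal (V y) ≤ ENNReal.ofReal (W t x) := by
    intro t ht x
    have := tsum_transitionProb_mul_le q (W := W) (W' := W') ?_ ?_ ?_ ?_ ?_ ht x
    · simpa [hWdef] using this
    · exact fun u hu x => add_nonneg (mul_nonneg (Real.exp_pos _).le (hV x))
        (mul_nonneg hK (hexp u hu))
    · intro u x
      have he : HasDerivAt (fun u => Real.exp (-c * u)) (Real.exp (-c * u) * (-c * 1)) u :=
        ((hasDerivAt_id u).const_mul (-c)).exp
      exact ((he.mul_const (V x)).add ((he.const_sub 1).const_mul K)).congr_deriv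
        (by simp only [hWdef']; ring)
    · intro x; simp only [hWdef']; fun_prop
    · intro u hu x
      rw [hid]
      exact add_nonneg (mul_nonneg (Real.exp_pos _).le (hnn x))
        (mul_nonneg ENNReal.toReal_nonneg (mul_nonneg hK (hexp u hu)))
    · intro u hu x
      have hKu := mul_nonneg hK (hexp u hu)
      rw [hid, ENNReal.ofReal_add (mul_nonneg (Real.exp_pos _).le (hnn x))
        (mul_nonneg ENNReal.toReal_nonneg hKu), ENNReal.ofReal_mul (Real.exp_pos _).le,
        ENNReal.ofReal_mul ENNReal.toReal_nonneg, ENNReal.ofReal_toReal (hq x)]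
      calc _ = ENNReal.ofReal (Real.exp (-c * u)) * ∑' w, q x w * ENNReal.ofReal (V w) +
            exitRate q x * ENNReal.ofReal (K * (1 - Real.exp (-c * u))) := by
            rw [exitRate, ← ENNReal.tsum_mul_left, ← ENNReal.tsum_mul_right, ← ENNReal.tsum_add]
            congr 1; funext w
            rw [hWdef, ENNReal.ofReal_add (mul_nonneg (Real.exp_pos _).le (hV w)) hKu,
              ENNReal.ofReal_mul (Real.exp_pos _).le]
            ring
        _ ≤ _ := by gcongr; exact hdrift x
  -- V is not known to be π-integrable, so stationarity is applied to V ∧ M; afterwards t → ∞, where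
  -- W tends to K, and then M → ∞.
  have hmin : ∀ M : ℕ, ∀ t, 0 ≤ t → ∫⁻ x, min (ENNReal.ofReal (V x)) M ∂π ≤
      ∫⁻ x, min (ENNReal.ofReal (W t x)) M ∂π := by
    intro M t ht
    rw [lintegral_countable', lintegral_countable']
    calc _ = ∑' x, (∑' y, transitionProb q t x y * min (ENNReal.ofReal (V y)) M) * π {x} := by
          simp_rw [← ENNReal.tsum_mul_right]
          rw [ENNReal.tsum_comm]
          congr 1; funext y
          rw [← h.tsum_eq ht y, ← ENNReal.tsum_mul_left]
          congr 1; funext x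
          ring
      _ ≤ _ := by
          gcongr with x
          refine le_min ?_ ?_
          · refine le_trans ?_ (hbound t ht x)
            gcongr
            exact min_le_left _ _
          · calc _ ≤ ∑' y, transitionProb q t x y * (M : ℝ≥0∞) := by
                  gcongr; exact min_le_right _ _
              _ ≤ _ := by
                  rw [ENNReal.tsum_mul_right]
                  exact mul_le_of_le_one_left' (tsum_transitionProb_le_one q hq ht x)
  have hlim : ∀ M : ℕ, ∫⁻ x, min (ENNReal.ofReal (V x)) M ∂π ≤ ENNReal.ofReal K := by
    intro M
    have ht : Tendsto (fun n : ℕ => ∫⁻ x, min (ENNReal.ofReal (W n x)) M ∂π) atTop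
        (𝓝 (∫⁻ _, min (ENNReal.ofReal K) M ∂π)) := by
      refine tendsto_lintegral_of_dominated_convergence (fun _ => (M : ℝ≥0∞))
        (fun n => measurable_of_countable _) (fun n => ae_of_all _ fun x => min_le_right _ _)
        (by simp) (ae_of_all _ fun x => ?_)
      have he : Tendsto (fun n : ℕ => Real.exp (-c * n)) atTop (𝓝 0) := by
        refine Real.tendsto_exp_atBot.comp ?_
        exact tendsto_natCast_atTop_atTop.const_mul_atTop_of_neg (neg_lt_zero.2 hc)
      have hW : Tendsto (fun n : ℕ => W n x) atTop (𝓝 (0 * V x + K * (1 - 0))) :=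
        (he.mul_const _).add ((he.const_sub 1).const_mul K)
      simp only [zero_mul, sub_zero, mul_one, zero_add] at hW
      exact (ENNReal.tendsto_ofReal hW).min tendsto_const_nhds
    refine (ge_of_tendsto' ht fun n => hmin M n n.cast_nonneg).trans ?_
    simp
  have hsup : ∀ x, ENNReal.ofReal (V x) = ⨆ M : ℕ, min (ENNReal.ofReal (V x)) M := fun x => by
    refine le_antisymm ?_ (iSup_le fun M => min_le_left _ _)
    obtain ⟨M, hM⟩ := ENNReal.exists_nat_gt (ENNReal.ofReal_ne_top (r := V x))
    exact (le_min le_rfl hM.le).trans (le_iSup (fun M : ℕ => min (ENNReal.ofReal (V x)) M) M)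
  rw [lintegral_congr hsup, lintegral_iSup (fun M => measurable_of_countable _)]
  · exact iSup_le hlim
  · intro M N hMN x
    dsimp only
    gcongr

end Stationary

/-! ### Existence of stationary distributions by Foster's criterion -/

section Existence

/-- Foster's criterion: a Markov chain with drift `-1` off a finite set has an invariant
measure. -/
theorem exists_invariant {S : Type*} [DecidableEq S] {J : S → S → ℝ≥0∞}
    (hJ : ∀ x, ∑' y, J x y = 1) {V : S → ℝ≥0∞} {C : Finset S} {b : ℝ≥0∞} (hb : b ≠ ∞)
    (hdrift : ∀ x, ∑' w, J x w * V w + 1 ≤ V x + if x ∈ C then b else 0)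
    {x₀ : S} (hx₀ : V x₀ ≠ ∞) :
    ∃ ν : S → ℝ≥0∞, ν ≠ 0 ∧ ∑' x, ν x ≤ 1 ∧ ∀ y, ∑' x, ν x * J x y = ν y := by
  -- `a n` is the law after n steps of the chain started at `x₀`.
  let a : ℕ → S → ℝ≥0∞ := fun n => n.rec (Pi.single x₀ 1) fun _ f y => ∑' x, f x * J x y
  have ha_succ : ∀ n y, a (n + 1) y = ∑' x, a n x * J x y := fun n y => rfl
  have hpush : ∀ n (f : S → ℝ≥0∞), ∑' y, a (n + 1) y * f y = ∑' x, a n x * ∑' y, J x y * f y := by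
    intro n f
    simp_rw [ha_succ, ← ENNReal.tsum_mul_right, ← ENNReal.tsum_mul_left]
    rw [ENNReal.tsum_comm]
    simp_rw [mul_assoc]
  have ha_one : ∀ n, ∑' y, a n y = 1 := by
    intro n
    induction n with
    | zero => exact tsum_pi_single x₀ 1
    | succ n ih =>
      have := hpush n (fun _ => 1)
      simp only [mul_one, hJ] at this
      rw [this, ih]
  -- Summing the drift condition bounds n by a constant plus b times the expected time spent in C.
  have hV : ∀ n : ℕ, ∑' y, a n y * V y + n ≤ V x₀ + b * ∑ j ∈ Finset.range n, ∑ x ∈ C, a j x := by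
    intro n
    induction n with
    | zero =>
      simp only [Nat.cast_zero, add_zero, Finset.range_zero, Finset.sum_empty, mul_zero]
      rw [tsum_eq_single x₀ fun y hy => by simp [a, hy]]
      simp [a]
    | succ n ih =>
      rw [hpush, Finset.sum_range_succ, mul_add, ← add_assoc]
      have h1 : ∑' x, a n x * ∑' y, J x y * V y + 1 ≤
          ∑' x, a n x * V x + b * ∑ x ∈ C, a n x := by
        calc _ = ∑' x, a n x * (∑' y, J x y * V y + 1) := by
              simp_rw [mul_add, mul_one]
              rw [ENNReal.tsum_add, ha_one]
          _ ≤ ∑' x, a n x * (V x + if x ∈ C then b else 0) :=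
              ENNReal.tsum_le_tsum fun x => mul_le_mul' le_rfl (hdrift x)
          _ = _ := by
              simp_rw [mul_add]
              rw [ENNReal.tsum_add]
              congr 1
              rw [tsum_eq_sum (s := C) (fun x hx => by simp [hx]), Finset.mul_sum]
              exact Finset.sum_congr rfl fun x hx => by simp [hx, mul_comm]
      calc _ = (∑' x, a n x * ∑' y, J x y * V y + 1) + n := by push_cast; ring
        _ ≤ (∑' x, a n x * V x + b * ∑ x ∈ C, a n x) + n := by gcongr
        _ = (∑' x, a n x * V x + n) + b * ∑ x ∈ C, a n x := by ring
        _ ≤ _ := by gcongr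
  set A : ℕ → S → ℝ≥0∞ := fun n y => ((n + 1 : ℕ) : ℝ≥0∞)⁻¹ * ∑ j ∈ Finset.range (n + 1), a j y
    with hA
  have hn0 : ∀ n : ℕ, ((n + 1 : ℕ) : ℝ≥0∞) ≠ 0 := fun n => by exact_mod_cast n.succ_ne_zero
  have hnt : ∀ n : ℕ, ((n + 1 : ℕ) : ℝ≥0∞) ≠ ∞ := fun n => ENNReal.natCast_ne_top _
  have hAone : ∀ n, ∑' y, A n y = 1 := by
    intro n
    simp only [hA]
    rw [ENNReal.tsum_mul_left, Summable.tsum_finsetSum (fun _ _ => ENNReal.summable)]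
    simp_rw [ha_one]
    simp only [Finset.sum_const, Finset.card_range, nsmul_eq_mul, mul_one]
    exact ENNReal.inv_mul_cancel (hn0 n) (hnt n)
  have hAC : ∀ n, 1 ≤ ((n + 1 : ℕ) : ℝ≥0∞)⁻¹ * V x₀ + b * ∑ x ∈ C, A n x := by
    intro n
    have h1 := le_trans le_add_self (hV (n + 1))
    calc (1 : ℝ≥0∞) = ((n + 1 : ℕ) : ℝ≥0∞)⁻¹ * (n + 1 : ℕ) :=
          (ENNReal.inv_mul_cancel (hn0 n) (hnt n)).symm
      _ ≤ ((n + 1 : ℕ) : ℝ≥0∞)⁻¹ *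
          (V x₀ + b * ∑ j ∈ Finset.range (n + 1), ∑ x ∈ C, a j x) := by gcongr
      _ = _ := by
          simp only [hA]
          rw [mul_add, ← Finset.mul_sum, Finset.sum_comm]
          ring
  have hAJ : ∀ n y, ∑' x, A n x * J x y ≤ A n y + ((n + 1 : ℕ) : ℝ≥0∞)⁻¹ := by
    intro n y
    have h1 : ∑' x, A n x * J x y =
        ((n + 1 : ℕ) : ℝ≥0∞)⁻¹ * ∑ j ∈ Finset.range (n + 1), a (j + 1) y := by
      simp only [hA, mul_assoc, ha_succ]
      rw [ENNReal.tsum_mul_left]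
      simp_rw [Finset.sum_mul]
      rw [Summable.tsum_finsetSum (fun _ _ => ENNReal.summable)]
    have h2 : ∑ j ∈ Finset.range (n + 1), a (j + 1) y ≤ ∑ j ∈ Finset.range (n + 1), a j y + 1 := by
      calc _ ≤ ∑ j ∈ Finset.range (n + 1), a (j + 1) y + a 0 y := le_self_add
        _ = ∑ j ∈ Finset.range (n + 1), a j y + a (n + 1) y :=
            (Finset.sum_range_succ' (fun j => a j y) (n + 1)).symm.trans
              (Finset.sum_range_succ (fun j => a j y) (n + 1))
        _ ≤ _ := by
            gcongr
            rw [← ha_one (n + 1)]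
            exact ENNReal.le_tsum y
    rw [h1]
    calc _ ≤ ((n + 1 : ℕ) : ℝ≥0∞)⁻¹ * (∑ j ∈ Finset.range (n + 1), a j y + 1) := by gcongr
      _ = _ := by rw [mul_add, mul_one]
  -- Along an ultrafilter the Cesàro averages `A n` converge at every state, by compactness of [0,
  -- ∞]. Mass may escape to infinity, but finite sums over C and one-sided bounds survive.
  let U : Ultrafilter ℕ := hyperfilter ℕ
  have hU : (U : Filter ℕ) ≤ atTop := Nat.hyperfilter_le_atTop
  have hlim : ∀ y, ∃ l, Tendsto (fun n => A n y) U (𝓝 l) := fun y =>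
    ⟨_, (U.map fun n => A n y).le_nhds_lim⟩
  choose ν hν using hlim
  have hinv : Tendsto (fun n : ℕ => ((n + 1 : ℕ) : ℝ≥0∞)⁻¹) U (𝓝 0) :=
    (ENNReal.tendsto_inv_nat_nhds_zero.comp (tendsto_add_atTop_nat 1)).mono_left hU
  have hνfin : ∑' x, ν x ≤ 1 := by
    rw [ENNReal.tsum_eq_iSup_sum]
    refine iSup_le fun F => ?_
    refine le_of_tendsto' (tendsto_finsetSum F fun x _ => hν x) fun n => ?_
    exact (ENNReal.sum_le_tsum F).trans (hAone n).le
  refine ⟨ν, ?_, hνfin, ?_⟩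
  -- The limit of `hAC` over the finite set C would read 1 ≤ 0.
  · rintro h0
    have h1 : Tendsto (fun n => ((n + 1 : ℕ) : ℝ≥0∞)⁻¹ * V x₀ + b * ∑ x ∈ C, A n x) U
        (𝓝 (0 * V x₀ + b * ∑ x ∈ C, ν x)) :=
      (ENNReal.Tendsto.mul_const hinv (Or.inr hx₀)).add
        (ENNReal.Tendsto.const_mul (tendsto_finsetSum C fun x _ => hν x) (Or.inr hb))
    have h2 := ge_of_tendsto' h1 hAC
    simp [h0] at h2
  · have hsub : ∀ y, ∑' x, ν x * J x y ≤ ν y := by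
      intro y
      rw [ENNReal.tsum_eq_iSup_sum]
      refine iSup_le fun F => ?_
      have hJt : ∀ x, J x y ≠ ∞ := fun x =>
        ne_top_of_le_ne_top ENNReal.one_ne_top ((ENNReal.le_tsum y).trans (hJ x).le)
      have h1 : Tendsto (fun n => ∑ x ∈ F, A n x * J x y) U (𝓝 (∑ x ∈ F, ν x * J x y)) :=
        tendsto_finsetSum F fun x _ => ENNReal.Tendsto.mul_const (hν x) (Or.inr (hJt x))
      have h2 : Tendsto (fun n => A n y + ((n + 1 : ℕ) : ℝ≥0∞)⁻¹) U (𝓝 (ν y + 0)) :=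
        (hν y).add hinv
      rw [add_zero] at h2
      exact le_of_tendsto_of_tendsto' h1 h2 fun n => (ENNReal.sum_le_tsum F).trans (hAJ n y)
    have hmass : ∑' y, ∑' x, ν x * J x y = ∑' x, ν x := by
      rw [ENNReal.tsum_comm]
      simp_rw [ENNReal.tsum_mul_left, hJ, mul_one]
    exact fun y => congrFun (eq_of_le_of_tsum_eq hsub hmass
      (hmass ▸ ne_top_of_le_ne_top ENNReal.one_ne_top hνfin)) y

variable {S : Type*} [DecidableEq S] {q : S → S → ℝ≥0∞}

/-- An honest chain with exit rates bounded below has a stationary distribution if its jump chain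
has drift `-1` off a finite set. -/
theorem exists_isStationaryDistribution [Countable S] [MeasurableSpace S]
    [MeasurableSingletonClass S] (hq : ∀ x, exitRate q x ≠ ∞)
    (hone : ∀ t, 0 ≤ t → ∀ x, ∑' y, transitionProb q t x y = 1)
    {l : ℝ≥0∞} (hl0 : l ≠ 0) (hl : ∀ x, l ≤ exitRate q x)
    {V : S → ℝ≥0∞} {C : Finset S} {b : ℝ≥0∞} (hb : b ≠ ∞)
    (hdrift : ∀ x, ∑' w, q x w * V w + exitRate q x ≤
      exitRate q x * (V x + if x ∈ C then b else 0))
    {x₀ : S} (hx₀ : V x₀ ≠ ∞) : ∃ π : Measure S, IsStationaryDistribution q π := by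
  have hq0 : ∀ x, exitRate q x ≠ 0 := fun x h => hl0 (le_zero_iff.1 (h ▸ hl x))
  obtain ⟨ν, hν0, hν1, hν⟩ := exists_invariant (J := fun x y => (exitRate q x)⁻¹ * q x y)
    (fun x => by
      rw [ENNReal.tsum_mul_left]
      exact ENNReal.inv_mul_cancel (hq0 x) (hq x)) hb (V := V) (C := C) (fun x => by
      calc _ = (exitRate q x)⁻¹ * (∑' w, q x w * V w + exitRate q x) := by
            rw [mul_add, ENNReal.inv_mul_cancel (hq0 x) (hq x), ← ENNReal.tsum_mul_left]
            simp_rw [mul_assoc]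
        _ ≤ (exitRate q x)⁻¹ * (exitRate q x * (V x + if x ∈ C then b else 0)) := by
            gcongr; exact hdrift x
        _ = _ := by rw [← mul_assoc, ENNReal.inv_mul_cancel (hq0 x) (hq x), one_mul]) hx₀
  -- Dividing by the exit rate turns invariance for the jump chain into the balance equations. The
  -- lower bound l on the exit rates keeps the total mass finite.
  set p : S → ℝ≥0∞ := fun x => ν x * (exitRate q x)⁻¹ with hp
  have hbal : ∀ y, ∑' x, p x * q x y = p y * exitRate q y := fun y => by
    simp only [hp, mul_assoc]
    rw [hν, ENNReal.inv_mul_cancel (hq0 y) (hq y), mul_one]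
  set Z := ∑' x, p x with hZ
  have hZ0 : Z ≠ 0 := by
    rw [hZ, Ne, ENNReal.tsum_eq_zero]
    intro h
    refine hν0 (funext fun x => ?_)
    exact (mul_eq_zero.1 (h x)).resolve_right (ENNReal.inv_ne_zero.2 (hq x))
  have hZt : Z ≠ ∞ := by
    have h1 : Z ≤ 1 * l⁻¹ := by
      calc Z ≤ ∑' x, ν x * l⁻¹ := by
            refine ENNReal.tsum_le_tsum fun x => ?_
            simp only [hp]
            gcongr
            exact hl x
        _ ≤ _ := by rw [ENNReal.tsum_mul_right]; gcongr
    refine ne_top_of_le_ne_top ?_ h1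
    simpa using hl0
  have hsum : ∑' x, p x * Z⁻¹ = 1 := by
    rw [ENNReal.tsum_mul_right]
    exact ENNReal.mul_inv_cancel hZ0 hZt
  let P : PMF S := ⟨fun x => p x * Z⁻¹, hsum ▸ ENNReal.summable.hasSum⟩
  have hPx : ∀ x, P.toMeasure {x} = p x * Z⁻¹ := fun x =>
    P.toMeasure_apply_singleton x (measurableSet_singleton x)
  refine ⟨P.toMeasure, inferInstance, fun t ht y => ?_⟩
  rw [lintegral_countable']
  simp_rw [hPx, ← mul_assoc]
  rw [ENNReal.tsum_mul_right]
  congr 1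
  have hmass : ∑' y, ∑' x, transitionProb q t x y * p x = ∑' x, p x := by
    rw [ENNReal.tsum_comm]
    simp_rw [ENNReal.tsum_mul_right, hone t ht, one_mul]
  exact congrFun (eq_of_le_of_tsum_eq (fun y => tsum_transitionProb_mul_le_of_balance q hq hbal ht y)
    hmass (hmass ▸ hZt)) y

end Existence

/-! ### The queue for fixed n: honesty, irreducibility, stationarity, exponential moments -/

section Queue

variable {m : ℕ} {r : Rates m} {n : ℕ} {z : (Fin m → ℕ) → (Fin m → ℕ)} {c : ℝ}

/-- Jobs in service and waiting jobs alike leave at rate at least c. Positive abandonment enters the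
stationary analysis here. -/
theorem Rates.mul_le_departureRate (hmu : ∀ i, c ≤ r.mu i) (hgam : ∀ i, c ≤ r.gam i)
    {x y : Fin m → ℕ} (hy : ∀ i, y i ≤ x i) (i : Fin m) : c * x i ≤ r.departureRate x y i := by
  have h1 : (y i : ℝ) ≤ x i := by exact_mod_cast hy i
  have h2 : (0 : ℝ) ≤ y i := Nat.cast_nonneg _
  unfold Rates.departureRate
  nlinarith [mul_le_mul_of_nonneg_right (hmu i) h2,
    mul_le_mul_of_nonneg_right (hgam i) (sub_nonneg.2 h1)]

/-- Makes truncated subtraction harmless: when class i is empty, x − e_i equals x but carries weight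
0. -/
theorem Rates.departureRate_eq_zero {x y : Fin m → ℕ} (hy : ∀ i, y i ≤ x i) {i : Fin m}
    (hx : x i = 0) : r.departureRate x y i = 0 := by
  have : y i = 0 := Nat.le_zero.1 (hx ▸ hy i)
  simp [Rates.departureRate, hx, this]

theorem sub_single_add_single {x : Fin m → ℕ} {i : Fin m} (hx : x i ≠ 0) :
    x - Pi.single i 1 + Pi.single i 1 = x := by
  funext j
  rcases eq_or_ne j i with rfl | h
  · simp only [Pi.add_apply, Pi.sub_apply, Pi.single_eq_same]; omega
  · simp [h]

theorem sum_add_single (x : Fin m → ℕ) (i : Fin m) :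
    ∑ j, (x + Pi.single i 1 : Fin m → ℕ) j = ∑ j, x j + 1 := by
  simp [Finset.sum_add_distrib]

theorem tsum_jumpRate_mul (hz : IsWorkConservingPolicy n z) (x : Fin m → ℕ)
    (f : (Fin m → ℕ) → ℝ≥0∞) :
    ∑' w, r.jumpRate z x w * f w = ∑ i, ENNReal.ofReal (r.lam i) * f (x + Pi.single i 1) +
      ∑ i, ENNReal.ofReal (r.departureRate x (z x) i) * f (x - Pi.single i 1) := by
  simp_rw [Rates.jumpRate, add_mul, Finset.sum_mul]
  rw [ENNReal.tsum_add, Summable.tsum_finsetSum (fun _ _ => ENNReal.summable),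
    Summable.tsum_finsetSum (fun _ _ => ENNReal.summable)]
  congr 1
  · refine Finset.sum_congr rfl fun i _ => ?_
    rw [tsum_eq_single (x + Pi.single i 1) (fun w hw => by simp [hw])]
    simp
  · refine Finset.sum_congr rfl fun i _ => ?_
    by_cases hx : x i = 0
    · simp [r.departureRate_eq_zero (hz x).1 hx]
    · rw [tsum_eq_single (x - Pi.single i 1) (fun w hw => ?_)]
      · simp [sub_single_add_single hx]
      · rw [if_neg, zero_mul]
        rintro rfl
        exact hw (by simp)

/-- The rates out of `x` act on functions of the total number of jobs as a birth-death chain. -/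
theorem tsum_jumpRate_mul_ofReal (hlam : ∀ i, 0 ≤ r.lam i) (hz : IsWorkConservingPolicy n z)
    (hdep : ∀ x i, 0 ≤ r.departureRate x (z x) i) (x : Fin m → ℕ) {g : ℕ → ℝ}
    (hg : ∀ k, 0 ≤ g k) :
    ∑' w, r.jumpRate z x w * ENNReal.ofReal (g (∑ j, w j)) =
      ENNReal.ofReal ((∑ i, r.lam i) * g (∑ j, x j + 1) +
        (∑ i, r.departureRate x (z x) i) * g (∑ j, x j - 1)) := by
  rw [tsum_jumpRate_mul hz, ENNReal.ofReal_add, Finset.sum_mul, Finset.sum_mul,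
    ENNReal.ofReal_sum_of_nonneg fun i _ => mul_nonneg (hlam i) (hg _),
    ENNReal.ofReal_sum_of_nonneg fun i _ => mul_nonneg (hdep x i) (hg _)]
  · congr 1
    · refine Finset.sum_congr rfl fun i _ => ?_
      rw [sum_add_single, ENNReal.ofReal_mul (hlam i)]
    · refine Finset.sum_congr rfl fun i _ => ?_
      rw [ENNReal.ofReal_mul (hdep x i)]
      by_cases hx : x i = 0
      · simp [r.departureRate_eq_zero (hz x).1 hx]
      · congr 3
        have := sum_add_single (x - Pi.single i 1) i
        rw [sub_single_add_single hx] at this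
        omega
  · exact mul_nonneg (Finset.sum_nonneg fun i _ => hlam i) (hg _)
  · exact mul_nonneg (Finset.sum_nonneg fun i _ => hdep x i) (hg _)

theorem exitRate_jumpRate (hlam : ∀ i, 0 ≤ r.lam i) (hz : IsWorkConservingPolicy n z)
    (hdep : ∀ x i, 0 ≤ r.departureRate x (z x) i) (x : Fin m → ℕ) :
    exitRate (r.jumpRate z) x =
      ENNReal.ofReal (∑ i, r.lam i + ∑ i, r.departureRate x (z x) i) := by
  have := tsum_jumpRate_mul_ofReal hlam hz hdep x (g := fun _ => 1) (fun _ => zero_le_one)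
  simpa [exitRate] using this

/-- Every state communicates with the empty one, by adding or removing one job at a time. -/
theorem reflTransGen_jumpRate (hlam : ∀ i, 0 < r.lam i)
    (hdep : ∀ x i, x i ≠ 0 → 0 < r.departureRate x (z x) i) (x y : Fin m → ℕ) :
    Relation.ReflTransGen (fun x y => r.jumpRate z x y ≠ 0) x y := by
  have hup : ∀ x i, r.jumpRate z x (x + Pi.single i 1) ≠ 0 := fun x i h => by
    have h1 := (add_eq_zero.1 h).1
    rw [Finset.sum_eq_zero_iff] at h1
    have := h1 i (Finset.mem_univ i)
    simp only [if_true, ENNReal.ofReal_eq_zero] at this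
    exact (hlam i).not_ge this
  have hdown : ∀ x i, r.jumpRate z (x + Pi.single i 1) x ≠ 0 := fun x i h => by
    have h1 := (add_eq_zero.1 h).2
    rw [Finset.sum_eq_zero_iff] at h1
    have := h1 i (Finset.mem_univ i)
    simp only [if_true, ENNReal.ofReal_eq_zero] at this
    exact (hdep _ i (by simp)).not_ge this
  have key : ∀ k : ℕ, ∀ x : Fin m → ℕ, ∑ j, x j = k →
      Relation.ReflTransGen (fun x y => r.jumpRate z x y ≠ 0) x 0 ∧
      Relation.ReflTransGen (fun x y => r.jumpRate z x y ≠ 0) 0 x := by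
    intro k
    induction k with
    | zero =>
      intro x hx
      have : x = 0 := funext fun i => (Finset.sum_eq_zero_iff.1 hx) i (Finset.mem_univ i)
      subst this
      exact ⟨.refl, .refl⟩
    | succ k ih =>
      intro x hx
      obtain ⟨i, -, hi⟩ : ∃ i ∈ Finset.univ, x i ≠ 0 :=
        Finset.exists_ne_zero_of_sum_ne_zero (by omega)
      have h1 := sub_single_add_single hi
      have h2 := sum_add_single (x - Pi.single i 1) i
      rw [h1] at h2
      obtain ⟨h3, h4⟩ := ih (x - Pi.single i 1) (by omega)
      have h5 := hup (x - Pi.single i 1) i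
      have h6 := hdown (x - Pi.single i 1) i
      rw [h1] at h5 h6
      exact ⟨h3.head h6, h4.tail h5⟩
  exact (key _ x rfl).1.trans (key _ y rfl).2

/-- Real-valued form of a drift condition that only involves the total number of jobs. -/
theorem tsum_jumpRate_mul_le (hlam : ∀ i, 0 ≤ r.lam i) (hz : IsWorkConservingPolicy n z)
    (hdep : ∀ x i, 0 ≤ r.departureRate x (z x) i) (x : Fin m → ℕ) {g : ℕ → ℝ}
    (hg : ∀ k, 0 ≤ g k) {B : ℝ}
    (h : (∑ i, r.lam i) * g (∑ j, x j + 1) +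
        (∑ i, r.departureRate x (z x) i) * g (∑ j, x j - 1) ≤ B) :
    0 ≤ B ∧ ∑' w, r.jumpRate z x w * ENNReal.ofReal (g (∑ j, w j)) ≤ ENNReal.ofReal B := by
  refine ⟨le_trans ?_ h, ?_⟩
  · exact add_nonneg (mul_nonneg (Finset.sum_nonneg fun i _ => hlam i) (hg _))
      (mul_nonneg (Finset.sum_nonneg fun i _ => hdep x i) (hg _))
  · rw [tsum_jumpRate_mul_ofReal hlam hz hdep x hg]
    exact ENNReal.ofReal_le_ofReal h

theorem toReal_exitRate_jumpRate (hlam : ∀ i, 0 ≤ r.lam i) (hz : IsWorkConservingPolicy n z)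
    (hdep : ∀ x i, 0 ≤ r.departureRate x (z x) i) (x : Fin m → ℕ) :
    (exitRate (r.jumpRate z) x).toReal = ∑ i, r.lam i + ∑ i, r.departureRate x (z x) i := by
  rw [exitRate_jumpRate hlam hz hdep, ENNReal.toReal_ofReal]
  exact add_nonneg (Finset.sum_nonneg fun i _ => hlam i) (Finset.sum_nonneg fun i _ => hdep x i)

theorem sum_departureRate_eq_zero (hz : IsWorkConservingPolicy n z) {x : Fin m → ℕ}
    (hx : ∑ j, x j = 0) : ∑ i, r.departureRate x (z x) i = 0 :=
  Finset.sum_eq_zero fun i _ => r.departureRate_eq_zero (hz x).1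
    ((Finset.sum_eq_zero_iff.1 hx) i (Finset.mem_univ i))

/-- The weight e^(3Lu) 2^N doubles at an arrival and halves at a departure. Since 2L + D/2 = (L + D
+ 3L)/2, the exponent 3L gives the contraction factor 1/2. -/
theorem tsum_transitionProb_jumpRate (hlam : ∀ i, 0 ≤ r.lam i) (hz : IsWorkConservingPolicy n z)
    (hdep : ∀ x i, 0 ≤ r.departureRate x (z x) i) {t : ℝ} (ht : 0 ≤ t) (x : Fin m → ℕ) :
    ∑' y, transitionProb (r.jumpRate z) t x y = 1 := by
  set L := ∑ i, r.lam i with hL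
  have hL0 : 0 ≤ L := Finset.sum_nonneg fun i _ => hlam i
  have key : ∀ u : ℝ, 0 ≤ u → ∀ x : Fin m → ℕ, _ := fun u _ x =>
    tsum_jumpRate_mul_le hlam hz hdep x (g := fun k => Real.exp (3 * L * u) * 2 ^ k)
    (B := 1 / 2 * ((exitRate (r.jumpRate z) x).toReal * (Real.exp (3 * L * u) * 2 ^ (∑ j, x j)) +
      3 * L * Real.exp (3 * L * u) * 2 ^ (∑ j, x j))) (fun k => by positivity) (by
    rw [toReal_exitRate_jumpRate hlam hz hdep, ← hL]
    have he := Real.exp_pos (3 * L * u)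
    rcases Nat.eq_zero_or_pos (∑ j, x j) with h0 | h0
    · rw [h0, sum_departureRate_eq_zero hz h0]
      simp only [zero_add, pow_one, pow_zero]
      nlinarith
    · obtain ⟨k, hk⟩ := Nat.exists_eq_succ_of_ne_zero h0.ne'
      rw [hk]
      simp only [Nat.succ_eq_add_one, Nat.add_sub_cancel, pow_succ]
      exact le_of_eq (by ring))
  refine tsum_transitionProb_eq_one (r.jumpRate z) (ρ := 1 / 2)
    (W := fun u x => Real.exp (3 * L * u) * 2 ^ (∑ j, x j))
    (W' := fun u x => 3 * L * Real.exp (3 * L * u) * 2 ^ (∑ j, x j))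
    (fun x => by rw [exitRate_jumpRate hlam hz hdep]; exact ENNReal.ofReal_ne_top)
    (by norm_num) (by norm_num) ?_ ?_ ?_ ?_ ?_ ht x
  · intro u hu x
    exact one_le_mul_of_one_le_of_one_le (Real.one_le_exp (by positivity))
      (one_le_pow₀ (by norm_num))
  · intro u x
    exact ((((hasDerivAt_id u).const_mul (3 * L)).exp).mul_const _).congr_deriv (by simp; ring)
  · intro x; fun_prop
  · intro u hu x; positivity
  · intro u hu x
    exact (key u hu x).2

theorem exists_isStationaryDistribution_jumpRate [Nonempty (Fin m)] (hlam : ∀ i, 0 < r.lam i)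
    (hz : IsWorkConservingPolicy n z) (hc : 0 < c)
    (hdep : ∀ x i, c * x i ≤ r.departureRate x (z x) i) :
    ∃ π : Measure (Fin m → ℕ), IsStationaryDistribution (r.jumpRate z) π := by
  have hlam' : ∀ i, 0 ≤ r.lam i := fun i => (hlam i).le
  have hdep' : ∀ x i, 0 ≤ r.departureRate x (z x) i := fun x i =>
    le_trans (by positivity) (hdep x i)
  set L := ∑ i, r.lam i with hL
  have hL0 : 0 < L := Finset.sum_pos (fun i _ => hlam i) Finset.univ_nonempty
  -- With V = 2N the drift requirement is 3L − D ≤ 0 off C. Outside the box of side R one has D ≥ cN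
  -- ≥ cR ≥ 3L; inside it b = 3 suffices.
  obtain ⟨R, hR⟩ := exists_nat_ge (3 * L / c)
  have hex := exitRate_jumpRate hlam' hz hdep'
  rw [← hL] at hex
  refine exists_isStationaryDistribution (l := ENNReal.ofReal L)
    (fun x => by rw [hex]; exact ENNReal.ofReal_ne_top)
    (fun t ht x => tsum_transitionProb_jumpRate hlam' hz hdep' ht x) (by simpa using hL0)
    (fun x => ?_) (V := fun x => ENNReal.ofReal (2 * (∑ j, x j : ℕ)))
    (C := Finset.Iic fun _ => R) (b := ENNReal.ofReal 3) ENNReal.ofReal_ne_top (fun x => ?_)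
    (x₀ := 0) ENNReal.ofReal_ne_top
  · rw [hex]
    exact ENNReal.ofReal_le_ofReal (le_add_of_nonneg_right (Finset.sum_nonneg fun i _ => hdep' x i))
  · rw [tsum_jumpRate_mul_ofReal hlam' hz hdep' x (g := fun k => 2 * (k : ℝ))
      (fun k => by positivity), hex, ← hL]
    set D := ∑ i, r.departureRate x (z x) i with hD
    have hD0 : 0 ≤ D := Finset.sum_nonneg fun i _ => hdep' x i
    have hDx : c * (∑ j, x j : ℕ) ≤ D := by
      push_cast
      rw [Finset.mul_sum]
      exact Finset.sum_le_sum fun i _ => hdep x i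
    have hb : (if x ∈ Finset.Iic (fun _ : Fin m => R) then ENNReal.ofReal 3 else 0) =
        ENNReal.ofReal (if x ∈ Finset.Iic (fun _ : Fin m => R) then 3 else 0) := by
      split_ifs <;> simp
    have hite : (0 : ℝ) ≤ if x ∈ Finset.Iic (fun _ : Fin m => R) then 3 else 0 := by
      split_ifs <;> norm_num
    rw [hb, ← ENNReal.ofReal_add (by positivity) hite,
      ← ENNReal.ofReal_mul (by positivity), ← ENNReal.ofReal_add (by positivity) (by positivity)]
    refine ENNReal.ofReal_le_ofReal ?_
    have h1 : D * (2 * ((∑ j, x j - 1 : ℕ) : ℝ)) = D * (2 * ((∑ j, x j : ℕ) - 1)) := by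
      rcases Nat.eq_zero_or_pos (∑ j, x j) with h0 | h0
      · rw [hD, sum_departureRate_eq_zero hz h0]; simp
      · rw [Nat.cast_sub h0]; simp
    rw [h1]
    have h2 : 3 * L - D ≤ (L + D) * if x ∈ Finset.Iic (fun _ : Fin m => R) then (3 : ℝ) else 0 := by
      split_ifs with hx
      · linarith
      · rw [Finset.mem_Iic, Pi.le_def] at hx
        push Not at hx
        obtain ⟨i, hi⟩ := hx
        have h3 : R ≤ ∑ j, x j := hi.le.trans (Finset.single_le_sum (fun _ _ => Nat.zero_le _)
          (Finset.mem_univ i))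
        have h4 : (R : ℝ) ≤ (∑ j, x j : ℕ) := by exact_mod_cast h3
        rw [div_le_iff₀ hc] at hR
        nlinarith
    push_cast at h2 ⊢
    linarith

/-- Exponential functions satisfy a drift condition for a birth-death chain whose death rate grows
at least linearly. -/
theorem exists_exp_drift {L a : ℝ} (hL0 : 0 ≤ L) (ha : 0 < a) (hc : 0 < c) :
    ∃ K : ℝ, 0 ≤ K ∧ ∀ (N : ℕ) (D : ℝ), c * N ≤ D → (N = 0 → D = 0) →
      L * Real.exp (a * (N + 1 : ℕ)) + D * Real.exp (a * (N - 1 : ℕ)) ≤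
        (L + D) * Real.exp (a * N) + 1 * (K - Real.exp (a * N)) := by
  have hea : 0 < 1 - Real.exp (-a) := by
    rw [sub_pos, Real.exp_lt_one_iff]; linarith
  have hea' : 0 ≤ Real.exp a - 1 := by
    rw [sub_nonneg]; exact Real.one_le_exp ha.le
  -- The drift of e^(aN) plus e^(aN) itself equals e^(aN) (M − D (1 − e^(−a))). It is nonpositive
  -- beyond the threshold M / (c (1 − e^(−a))), and K bounds it below the threshold.
  obtain ⟨M, hM⟩ : ∃ M, M = L * (Real.exp a - 1) + 1 := ⟨_, rfl⟩
  have hM0 : 0 < M := by rw [hM]; positivity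
  refine ⟨M * Real.exp (a * (M / (c * (1 - Real.exp (-a))))), by positivity,
    fun N D hDx hND => ?_⟩
  have h1 : D * Real.exp (a * ((N - 1 : ℕ) : ℝ)) = D * (Real.exp (-a) * Real.exp (a * N)) := by
    rcases Nat.eq_zero_or_pos N with h0 | h0
    · rw [hND h0]; simp
    · rw [Nat.cast_sub h0, ← Real.exp_add]; push_cast; ring_nf
  have h2 : Real.exp (a * ((N + 1 : ℕ) : ℝ)) = Real.exp a * Real.exp (a * N) := by
    rw [← Real.exp_add]; push_cast; ring_nf
  rw [h1, h2]
  have hE := Real.exp_pos (a * N)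
  have h3 : Real.exp (a * N) * (M - D * (1 - Real.exp (-a))) ≤
      M * Real.exp (a * (M / (c * (1 - Real.exp (-a))))) := by
    by_cases h : (N : ℝ) ≤ M / (c * (1 - Real.exp (-a)))
    · have h4 : Real.exp (a * N) ≤ Real.exp (a * (M / (c * (1 - Real.exp (-a))))) := by
        gcongr
      have h5 : 0 ≤ D := le_trans (by positivity) hDx
      have h6 : M - D * (1 - Real.exp (-a)) ≤ M := by linarith [mul_nonneg h5 hea.le]
      calc _ ≤ Real.exp (a * N) * M := by gcongr
        _ ≤ _ := by rw [mul_comm]; gcongr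
    · have h4 : M < N * (c * (1 - Real.exp (-a))) := by
        rw [not_le, div_lt_iff₀ (by positivity)] at h
        exact h
      have h5 : c * N * (1 - Real.exp (-a)) ≤ D * (1 - Real.exp (-a)) := by gcongr
      have h6 : M - D * (1 - Real.exp (-a)) ≤ 0 := by linarith
      exact (mul_nonpos_of_nonneg_of_nonpos hE.le h6).trans (by positivity)
  rw [hM] at h3 ⊢
  linarith

theorem IsStationaryDistribution.lintegral_exp_sum_lt_top (hlam : ∀ i, 0 ≤ r.lam i)
    (hz : IsWorkConservingPolicy n z) (hc : 0 < c)
    (hdep : ∀ x i, c * x i ≤ r.departureRate x (z x) i) {π : Measure (Fin m → ℕ)}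
    (hπ : IsStationaryDistribution (r.jumpRate z) π) {a : ℝ} (ha : 0 < a) :
    ∫⁻ x, ENNReal.ofReal (Real.exp (a * (∑ j, x j : ℕ))) ∂π < ∞ := by
  have hdep' : ∀ x i, 0 ≤ r.departureRate x (z x) i := fun x i =>
    le_trans (by positivity) (hdep x i)
  obtain ⟨K, hK0, hK⟩ := exists_exp_drift (Finset.sum_nonneg fun i (_ : i ∈ Finset.univ) => hlam i)
    ha hc
  have key : ∀ x : Fin m → ℕ, 0 ≤ (exitRate (r.jumpRate z) x).toReal *
        Real.exp (a * (∑ j, x j : ℕ)) + 1 * (K - Real.exp (a * (∑ j, x j : ℕ))) ∧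
      ∑' w, r.jumpRate z x w * ENNReal.ofReal (Real.exp (a * (∑ j, w j : ℕ))) ≤
        ENNReal.ofReal ((exitRate (r.jumpRate z) x).toReal *
          Real.exp (a * (∑ j, x j : ℕ)) + 1 * (K - Real.exp (a * (∑ j, x j : ℕ)))) := by
    intro x
    rw [toReal_exitRate_jumpRate hlam hz hdep']
    refine tsum_jumpRate_mul_le hlam hz hdep' x (g := fun k => Real.exp (a * k))
      (fun k => (Real.exp_pos _).le) (hK _ _ ?_ (sum_departureRate_eq_zero hz))
    push_cast
    rw [Finset.mul_sum]
    exact Finset.sum_le_sum fun i _ => hdep x i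
  have hfin : ∀ x, exitRate (r.jumpRate z) x ≠ ∞ := fun x => by
    rw [exitRate_jumpRate hlam hz hdep']; exact ENNReal.ofReal_ne_top
  have hV : ∀ x : Fin m → ℕ, 0 ≤ Real.exp (a * (∑ j, x j : ℕ)) := fun x => (Real.exp_pos _).le
  have h := hπ.lintegral_le hfin hV one_pos hK0 (fun x => (key x).1) (fun x => (key x).2)
  exact h.trans_lt ENNReal.ofReal_lt_top

theorem l1norm_scaledState_le (hn : 0 < n) (x : Fin m → ℕ) :
    l1norm (r.scaledState n x) ≤ 1 / √(n : ℝ) * (∑ j, x j : ℕ) +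
      ∑ i, (|r.lam i / r.mu i| / √(n : ℝ) + |r.spareCapacity n / m|) := by
  have hs : 0 < √(n : ℝ) := Real.sqrt_pos.2 (by exact_mod_cast hn)
  push_cast
  rw [l1norm, Finset.mul_sum, ← Finset.sum_add_distrib]
  refine Finset.sum_le_sum fun i _ => ?_
  simp only [Rates.scaledState, Rates.scale]
  refine (abs_sub _ _).trans ?_
  rw [← add_assoc]
  gcongr
  rw [abs_div, abs_of_pos hs, one_div, inv_mul_eq_div, ← add_div]
  gcongr
  refine (abs_sub _ _).trans ?_
  rw [abs_of_nonneg (Nat.cast_nonneg (x i))]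

/-- For fixed n the scaled norm is at most N/√n plus a constant, so its exponential moments reduce
to those of N at rate η/√n. -/
theorem existsUnique_isStationaryDistribution_and_integrable [Nonempty (Fin m)] (hn : 0 < n)
    (hlam : ∀ i, 0 < r.lam i) (hc : 0 < c) (hmu : ∀ i, c ≤ r.mu i) (hgam : ∀ i, c ≤ r.gam i)
    (hz : IsWorkConservingPolicy n z) :
    (∃! π : Measure (Fin m → ℕ), IsStationaryDistribution (r.jumpRate z) π) ∧
      ∀ π : Measure (Fin m → ℕ), IsStationaryDistribution (r.jumpRate z) π →
        ∀ η : ℝ, 0 < η →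
          Integrable (fun x => Real.exp (η * l1norm (r.scaledState n x))) π := by
  have hlam' : ∀ i, 0 ≤ r.lam i := fun i => (hlam i).le
  have hdep : ∀ x i, c * x i ≤ r.departureRate x (z x) i := fun x i =>
    Rates.mul_le_departureRate hmu hgam (hz x).1 i
  have hdep' : ∀ x i, 0 ≤ r.departureRate x (z x) i := fun x i =>
    le_trans (by positivity) (hdep x i)
  constructor
  · obtain ⟨π, hπ⟩ := exists_isStationaryDistribution_jumpRate hlam hz hc hdep
    refine ⟨π, hπ, fun π' hπ' => ?_⟩
    refine IsStationaryDistribution.unique (reflTransGen_jumpRate hlam fun x i hx => ?_)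
      (fun t ht x => tsum_transitionProb_jumpRate hlam' hz hdep' ht x) hπ' hπ
    have : 0 < (x i : ℝ) := by exact_mod_cast Nat.pos_of_ne_zero hx
    exact lt_of_lt_of_le (by positivity) (hdep x i)
  · intro π hπ η hη
    have hs : 0 < √(n : ℝ) := Real.sqrt_pos.2 (by exact_mod_cast hn)
    set B := ∑ i, (|r.lam i / r.mu i| / √(n : ℝ) + |r.spareCapacity n / m|) with hB
    have hfin := hπ.lintegral_exp_sum_lt_top hlam' hz hc hdep (a := η * (1 / √(n : ℝ)))
      (by positivity)
    refine ⟨(measurable_of_countable _).aestronglyMeasurable, ?_⟩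
    rw [hasFiniteIntegral_iff_ofReal (ae_of_all _ fun x => (Real.exp_pos _).le)]
    calc _ ≤ ∫⁻ x, ENNReal.ofReal (Real.exp (η * B)) *
          ENNReal.ofReal (Real.exp (η * (1 / √(n : ℝ)) * (∑ j, x j : ℕ))) ∂π := by
          refine lintegral_mono fun x => ?_
          rw [← ENNReal.ofReal_mul (Real.exp_pos _).le, ← Real.exp_add]
          refine ENNReal.ofReal_le_ofReal (Real.exp_le_exp.2 ?_)
          have := mul_le_mul_of_nonneg_left (l1norm_scaledState_le (r := r) hn x) hη.le
          rw [← hB] at this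
          linarith
      _ < ∞ := by
          rw [lintegral_const_mul' _ _ ENNReal.ofReal_ne_top]
          exact ENNReal.mul_lt_top ENNReal.ofReal_lt_top hfin

end Queue

/-! ### Calculus of ψ and of one factor of the Lyapunov function -/

section Psi

/-- Glues the branches of `psi` at −1 and 0, where their derivatives agree. -/
theorem hasDerivAt_of_eventually_eq_left_right {f g h : ℝ → ℝ} {a d : ℝ} (hg : HasDerivAt g d a)
    (hh : HasDerivAt h d a) (h1 : ∀ᶠ t in 𝓝 a, t ≤ a → f t = g t)
    (h2 : ∀ᶠ t in 𝓝 a, a ≤ t → f t = h t) : HasDerivAt f d a := by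
  rw [← hasDerivWithinAt_univ, ← Set.Iic_union_Ici (a := a)]
  refine HasDerivWithinAt.union ?_ ?_
  · exact hg.hasDerivWithinAt.congr_of_eventuallyEq
      (eventually_nhdsWithin_iff.2 (h1.mono fun t ht hta => ht hta)) (h1.self_of_nhds le_rfl)
  · exact hh.hasDerivWithinAt.congr_of_eventuallyEq
      (eventually_nhdsWithin_iff.2 (h2.mono fun t ht hta => ht hta)) (h2.self_of_nhds le_rfl)

/-- The derivative of `psi`. -/
noncomputable def dpsi (t : ℝ) : ℝ :=
  3 * (max 0 (min 1 (t + 1))) ^ 2 - 2 * (max 0 (min 1 (t + 1))) ^ 3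

theorem dpsi_of_nonneg {t : ℝ} (ht : 0 ≤ t) : dpsi t = 1 := by
  rw [dpsi, min_eq_left (by linarith), max_eq_right zero_le_one]; norm_num

theorem dpsi_of_le {t : ℝ} (ht : t ≤ -1) : dpsi t = 0 := by
  rw [dpsi, min_eq_right (by linarith), max_eq_left (by linarith)]; norm_num

theorem dpsi_of_mem {t : ℝ} (h1 : -1 ≤ t) (h2 : t ≤ 0) :
    dpsi t = 3 * (t + 1) ^ 2 - 2 * (t + 1) ^ 3 := by
  rw [dpsi, min_eq_right (by linarith), max_eq_right (by linarith)]

theorem dpsi_mem (t : ℝ) : 0 ≤ dpsi t ∧ dpsi t ≤ 1 := by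
  have h0 : 0 ≤ max 0 (min 1 (t + 1)) := le_max_left _ _
  have h1 : max 0 (min 1 (t + 1)) ≤ 1 := max_le zero_le_one (min_le_left _ _)
  unfold dpsi
  set s := max 0 (min 1 (t + 1))
  constructor
  · nlinarith [mul_nonneg (sq_nonneg s) (sub_nonneg.2 h1), sq_nonneg s]
  · nlinarith [mul_nonneg (sq_nonneg (1 - s)) h0, sq_nonneg (1 - s)]

/-- `dpsi` is 3s² − 2s³ at the clamp s of t + 1 to [0, 1]. The clamp is 1-Lipschitz and the divided
difference of the polynomial is at most 6 in modulus. -/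
theorem abs_dpsi_sub_le (t u : ℝ) : |dpsi t - dpsi u| ≤ 6 * |t - u| := by
  have hst : |max 0 (min 1 (t + 1)) - max 0 (min 1 (u + 1))| ≤ |t - u| := by
    exact (abs_max_sub_max_le_max 0 _ 0 _).trans (max_le (by simp)
      ((abs_min_sub_min_le_max 1 _ 1 _).trans (max_le (by simp) (by simp))))
  have h0 : 0 ≤ max 0 (min 1 (t + 1)) := le_max_left _ _
  have h1 : max 0 (min 1 (t + 1)) ≤ 1 := max_le zero_le_one (min_le_left _ _)
  have k0 : 0 ≤ max 0 (min 1 (u + 1)) := le_max_left _ _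
  have k1 : max 0 (min 1 (u + 1)) ≤ 1 := max_le zero_le_one (min_le_left _ _)
  unfold dpsi
  set s := max 0 (min 1 (t + 1))
  set v := max 0 (min 1 (u + 1))
  have hfac : 3 * s ^ 2 - 2 * s ^ 3 - (3 * v ^ 2 - 2 * v ^ 3) =
      (3 * (s + v) - 2 * (s ^ 2 + s * v + v ^ 2)) * (s - v) := by ring
  rw [hfac, abs_mul]
  have hb : |3 * (s + v) - 2 * (s ^ 2 + s * v + v ^ 2)| ≤ 6 := by
    rw [abs_le]
    constructor <;> nlinarith [mul_nonneg h0 k0, mul_nonneg h0 (sub_nonneg.2 h1),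
      mul_nonneg k0 (sub_nonneg.2 k1), mul_nonneg h0 (sub_nonneg.2 k1), sq_nonneg (s - v)]
  exact mul_le_mul hb hst (abs_nonneg _) (by norm_num)

theorem hasDerivAt_psi (t : ℝ) : HasDerivAt psi (dpsi t) t := by
  have hpoly : ∀ t : ℝ, HasDerivAt (fun t : ℝ => (t + 1) ^ 3 - (t + 1) ^ 4 / 2 - 1 / 2)
      (3 * (t + 1) ^ 2 - 2 * (t + 1) ^ 3) t := fun t => by
    have h1 : HasDerivAt (fun t : ℝ => t + 1) 1 t := (hasDerivAt_id t).add_const 1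
    exact (((h1.pow 3).sub ((h1.pow 4).div_const 2)).sub_const _).congr_deriv (by
      push_cast; ring)
  have hlow : ∀ s : ℝ, s ≤ -1 → psi s = -1 / 2 := fun s hs => by simp [psi, hs]
  have hmid : ∀ s : ℝ, -1 ≤ s → s ≤ 0 → psi s = (s + 1) ^ 3 - (s + 1) ^ 4 / 2 - 1 / 2 := by
    intro s h1 h2
    rcases h1.eq_or_lt with rfl | h1
    · rw [hlow _ le_rfl]; norm_num
    · simp [psi, h1.not_ge, h2]
  have hhigh : ∀ s : ℝ, 0 ≤ s → psi s = s := by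
    intro s h
    rcases h.eq_or_lt with rfl | h
    · rw [hmid 0 (by norm_num) le_rfl]; norm_num
    · simp [psi, h.not_ge, (show ¬ s ≤ -1 by linarith)]
  have hconst := fun t : ℝ => hasDerivAt_const t (-1 / 2 : ℝ)
  rcases lt_or_ge t (-1) with h | h
  · rw [dpsi_of_le h.le]
    exact (hconst t).congr_of_eventuallyEq ((gt_mem_nhds h).mono fun s hs => hlow s hs.le)
  rcases h.eq_or_lt with rfl | h
  · rw [dpsi_of_le le_rfl]
    refine hasDerivAt_of_eventually_eq_left_right (hconst _)
      ((hpoly (-1)).congr_deriv (by norm_num)) (.of_forall fun s hs => hlow s hs)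
      ((gt_mem_nhds (show (-1 : ℝ) < 0 by norm_num)).mono fun s hs hs' => hmid s hs' hs.le)
  rcases lt_or_ge t 0 with h' | h'
  · rw [dpsi_of_mem h.le h'.le]
    exact (hpoly t).congr_of_eventuallyEq
      (mem_of_superset (Ioo_mem_nhds h h') fun s hs => hmid s hs.1.le hs.2.le)
  rcases h'.eq_or_lt with rfl | h'
  · rw [dpsi_of_nonneg le_rfl]
    refine hasDerivAt_of_eventually_eq_left_right ((hpoly 0).congr_deriv (by norm_num))
      (hasDerivAt_id 0) ?_ (.of_forall fun s hs => hhigh s hs)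
    exact (lt_mem_nhds (show (-1 : ℝ) < 0 by norm_num)).mono fun s hs hs' => hmid s hs.le hs'
  · rw [dpsi_of_nonneg h'.le]
    exact (hasDerivAt_id t).congr_of_eventuallyEq ((lt_mem_nhds h').mono fun s hs => hhigh s hs.le)

/-- Mean value inequality for s ↦ ψ(s) − s ψ'(t): a Lipschitz derivative replaces a second
derivative. -/
theorem abs_psi_add_sub_sub_le (t h : ℝ) : |psi (t + h) - psi t - h * dpsi t| ≤ 6 * h ^ 2 := by
  have key := Convex.norm_image_sub_le_of_norm_hasDerivWithin_le
    (f := fun s => psi s - s * dpsi t) (f' := fun s => dpsi s - 1 * dpsi t) (C := 6 * |h|)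
    (s := Set.uIcc t (t + h)) (x := t) (y := t + h)
    (fun s _ => ((hasDerivAt_psi s).sub ((hasDerivAt_id s).mul_const _)).hasDerivWithinAt)
    (fun s hs => by
      rw [one_mul, Real.norm_eq_abs]
      refine (abs_dpsi_sub_le s t).trans ?_
      have := Set.abs_sub_left_of_mem_uIcc hs
      rw [add_sub_cancel_left] at this
      gcongr) (convex_uIcc _ _) Set.left_mem_uIcc Set.right_mem_uIcc
  simp only [Real.norm_eq_abs, add_sub_cancel_left] at key
  calc _ = |psi (t + h) - (t + h) * dpsi t - (psi t - t * dpsi t)| := by congr 1; ring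
    _ ≤ 6 * |h| * |h| := key
    _ = 6 * h ^ 2 := by rw [mul_assoc, ← sq, sq_abs]

theorem psi_le_abs (t : ℝ) : psi t ≤ |t| := by
  unfold psi
  split_ifs with h1 h2
  · exact le_trans (by norm_num) (abs_nonneg t)
  · refine le_trans ?_ (abs_nonneg t)
    nlinarith [sq_nonneg (t + 1), sq_nonneg ((t + 1) ^ 2 - (t + 1)), mul_nonneg
      (neg_nonneg.2 h2) (show 0 ≤ t + 1 by linarith), sq_nonneg t, sq_nonneg (t * (t + 1))]
  · exact le_abs_self t

/-- The derivative of `t ↦ ψ(t) + θ ψ(-t)`. -/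
noncomputable def slope (θ t : ℝ) : ℝ := dpsi t - θ * dpsi (-t)

variable {θ : ℝ}

theorem slope_mem (h0 : 0 ≤ θ) (t : ℝ) : -θ ≤ slope θ t ∧ slope θ t ≤ 1 := by
  have h1 := dpsi_mem t
  have h2 := dpsi_mem (-t)
  unfold slope
  constructor <;> nlinarith [mul_nonneg h0 h2.1, mul_nonneg h0 (sub_nonneg.2 h2.2)]

theorem abs_slope_le (h0 : 0 ≤ θ) (h1 : θ ≤ 1) (t : ℝ) : |slope θ t| ≤ 1 :=
  abs_le.2 ⟨by linarith [(slope_mem h0 t).1], (slope_mem h0 t).2⟩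

/-- For |t| ≥ 1 the slope is exactly 1 or −θ; the slack 2 covers |t| < 1. -/
theorem neg_slope_mul_le (h0 : 0 ≤ θ) (h1 : θ ≤ 1) (t : ℝ) :
    -(slope θ t * t) ≤ 2 - max t 0 - θ * max (-t) 0 := by
  rcases le_or_gt 1 t with h | h
  · rw [slope, dpsi_of_nonneg (by linarith), dpsi_of_le (by linarith), max_eq_left (by linarith),
      max_eq_right (by linarith)]
    linarith
  rcases le_or_gt t (-1) with h' | h'
  · rw [slope, dpsi_of_le h', dpsi_of_nonneg (by linarith), max_eq_right (by linarith),
      max_eq_left (by linarith)]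
    linarith
  · have h2 : |slope θ t * t| ≤ 1 := by
      rw [abs_mul]
      exact mul_le_one₀ (abs_slope_le h0 h1 t) (abs_nonneg t) (abs_le.2 ⟨h'.le, h.le⟩)
    have h3 := neg_abs_le (slope θ t * t)
    rcases le_total 0 t with h4 | h4
    · rw [max_eq_left h4, max_eq_right (by linarith)]; linarith
    · rw [max_eq_right h4, max_eq_left (by linarith)]; nlinarith

/-- A linear function of the slope is largest at an endpoint of [−θ, 1]. -/
theorem slope_mul_le (h0 : 0 ≤ θ) {b M : ℝ} (h1 : b ≤ M) (h2 : -(θ * b) ≤ M) (t : ℝ) :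
    slope θ t * b ≤ M := by
  obtain ⟨h3, h4⟩ := slope_mem h0 t
  rcases le_total 0 b with hb | hb <;> nlinarith

/-- Second-order expansion of one factor of the Lyapunov function. -/
theorem exp_sub_one_le {c C t δ : ℝ} (h0 : 0 ≤ θ) (h1 : θ ≤ 1) (hc : 0 ≤ c) (hcC : c ≤ C)
    (hδ : |δ| ≤ 1) (hδ' : 13 * C * |δ| ≤ 1) :
    Real.exp (c * (psi (t + δ) + θ * psi (-(t + δ))) - c * (psi t + θ * psi (-t))) - 1 ≤
      δ * (c * slope θ t) + (12 * C + 169 * C ^ 2) * δ ^ 2 := by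
  -- 12 = 6 + 6 comes from the Taylor remainders at t and −t; 13 = 12 + 1 also counts the linear
  -- term; 169 = 13² enters through |e^h − 1 − h| ≤ h².
  set h := c * (psi (t + δ) + θ * psi (-(t + δ))) - c * (psi t + θ * psi (-t)) with hh
  have hp := abs_psi_add_sub_sub_le t δ
  have hm := abs_psi_add_sub_sub_le (-t) (-δ)
  rw [← neg_add, neg_sq] at hm
  have hδ2 : 0 ≤ δ ^ 2 := sq_nonneg δ
  have herr : |h - δ * (c * slope θ t)| ≤ 12 * c * δ ^ 2 := by
    have hid : h - δ * (c * slope θ t) = c * ((psi (t + δ) - psi t - δ * dpsi t) +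
        θ * (psi (-(t + δ)) - psi (-t) - -δ * dpsi (-t))) := by
      rw [hh, slope]; ring
    rw [hid, abs_mul, abs_of_nonneg hc]
    have : |(psi (t + δ) - psi t - δ * dpsi t) +
        θ * (psi (-(t + δ)) - psi (-t) - -δ * dpsi (-t))| ≤ 6 * δ ^ 2 + 1 * (6 * δ ^ 2) := by
      refine (abs_add_le _ _).trans (add_le_add hp ?_)
      rw [abs_mul, abs_of_nonneg h0]
      exact mul_le_mul h1 hm (abs_nonneg _) zero_le_one
    calc _ ≤ c * (6 * δ ^ 2 + 1 * (6 * δ ^ 2)) := by gcongr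
      _ = _ := by ring
  have hsq : δ ^ 2 ≤ |δ| := by
    rw [← sq_abs]; nlinarith [abs_nonneg δ]
  have hlin : |δ * (c * slope θ t)| ≤ c * |δ| := by
    rw [abs_mul, abs_mul, abs_of_nonneg hc]
    nlinarith [abs_slope_le h0 h1 t, mul_nonneg (abs_nonneg δ) hc]
  have habs : |h| ≤ 13 * C * |δ| := by
    have h2 : |h| ≤ |h - δ * (c * slope θ t)| + |δ * (c * slope θ t)| := by
      simpa using abs_add_le (h - δ * (c * slope θ t)) (δ * (c * slope θ t))
    have h3 : c * δ ^ 2 ≤ c * |δ| := by gcongr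
    have h4 : c * |δ| ≤ C * |δ| := by gcongr
    linarith
  have hexp := (abs_le.1 (Real.abs_exp_sub_one_sub_id_le (habs.trans hδ'))).2
  have hh2 : h ^ 2 ≤ 169 * C ^ 2 * δ ^ 2 := by
    have := pow_le_pow_left₀ (abs_nonneg h) habs 2
    rw [sq_abs, mul_pow, sq_abs, mul_pow] at this
    linarith
  have h5 := (abs_le.1 herr).2
  have h6 : c * δ ^ 2 ≤ C * δ ^ 2 := by gcongr
  linarith

end Psi

/-! ### The drift inequality with explicit constants -/

section Drift

variable {m : ℕ} {r : Rates m} {n : ℕ}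

/-- The terms −y_i yield −y_i⁺ − θ y_i⁻, and the queue costs at most M Σ q_i ≤ M Σ y_i⁺ however it
is split among classes. What remains is (1 − M) y_i⁺ + θ y_i⁻ ≥ κ |y_i|. -/
theorem sum_slope_mul_le {y q b : Fin m → ℝ} {θ M κ e A : ℝ} (h0 : 0 ≤ θ) (h1 : θ ≤ 1)
    (hq : ∀ i, 0 ≤ q i) (hqy : ∑ i, q i = max (∑ i, y i) 0) (hM : 0 ≤ M) (hb : ∀ i, b i ≤ M)
    (hb' : ∀ i, -(θ * b i) ≤ M) (hκM : κ ≤ 1 - M) (hκθ : κ ≤ θ) (he : |e| ≤ A) :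
    ∑ i, slope θ (y i) * (-(y i + e) + b i * q i) ≤ m * (2 + A) - κ * ∑ i, |y i| := by
  have hterm : ∀ i, slope θ (y i) * (-(y i + e) + b i * q i) ≤
      (2 + A) - max (y i) 0 - θ * max (-y i) 0 + M * q i := by
    intro i
    have h2 := neg_slope_mul_le h0 h1 (y i)
    have h3 := mul_le_mul_of_nonneg_right (slope_mul_le h0 (hb i) (hb' i) (y i)) (hq i)
    have h4 : -(slope θ (y i) * e) ≤ A := by
      refine (neg_le_abs _).trans ?_
      rw [abs_mul]
      exact (mul_le_of_le_one_left (abs_nonneg e) (abs_slope_le h0 h1 _)).trans he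
    linarith
  have hmax : max (∑ i, y i) 0 ≤ ∑ i, max (y i) 0 :=
    max_le (Finset.sum_le_sum fun i _ => le_max_left _ _)
      (Finset.sum_nonneg fun i _ => le_max_right _ _)
  calc _ ≤ ∑ i, ((2 + A) - max (y i) 0 - θ * max (-y i) 0 + M * q i) :=
        Finset.sum_le_sum fun i _ => hterm i
    _ = ∑ i, ((2 + A) - max (y i) 0 - θ * max (-y i) 0) + M * ∑ i, q i := by
        rw [Finset.sum_add_distrib, Finset.mul_sum]
    _ ≤ ∑ i, ((2 + A) - max (y i) 0 - θ * max (-y i) 0) + M * ∑ i, max (y i) 0 := by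
        rw [hqy]; gcongr
    _ = ∑ i, ((2 + A) - (1 - M) * max (y i) 0 - θ * max (-y i) 0) := by
        rw [Finset.mul_sum, ← Finset.sum_add_distrib]
        exact Finset.sum_congr rfl fun i _ => by ring
    _ ≤ ∑ i, ((2 + A) - κ * |y i|) := by
        refine Finset.sum_le_sum fun i _ => ?_
        rcases le_total 0 (y i) with h | h
        · rw [max_eq_left h, max_eq_right (by linarith), abs_of_nonneg h]; nlinarith
        · rw [max_eq_right h, max_eq_left (by linarith), abs_of_nonpos h]; nlinarith
    _ = _ := by
        rw [Finset.sum_sub_distrib, ← Finset.mul_sum]; simp; ring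

theorem Rates.lyapunov_eq (r : Rates m) (η : ℝ) (w : Fin m → ℝ) :
    r.lyapunov η w = Real.exp (∑ i, η / r.mu i * (psi (w i) + r.theta * psi (-w i))) := by
  rw [Rates.lyapunov, Rates.Psi, Rates.Psi, Finset.mul_sum, Finset.mul_sum,
    ← Finset.sum_add_distrib]
  congr 1
  exact Finset.sum_congr rfl fun i _ => by simp only [Pi.neg_apply]; ring

theorem Rates.lyapunov_add_single (r : Rates m) (η : ℝ) (w : Fin m → ℝ) (i : Fin m) (δ : ℝ) :
    r.lyapunov η (w + Pi.single i δ) = r.lyapunov η w * Real.exp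
      (η / r.mu i * (psi (w i + δ) + r.theta * psi (-(w i + δ))) -
        η / r.mu i * (psi (w i) + r.theta * psi (-w i))) := by
  rw [r.lyapunov_eq, r.lyapunov_eq, ← Real.exp_add]
  congr 1
  rw [← sub_eq_iff_eq_add', ← Finset.sum_sub_distrib, Finset.sum_eq_single i]
  · simp
  · intro j _ hj; simp [hj]
  · simp

theorem Rates.scale_add_single (r : Rates m) (n : ℕ) (x : Fin m → ℝ) (i : Fin m) (δ : ℝ) :
    r.scale n (x + Pi.single i δ) = r.scale n x + Pi.single i (δ / √(n : ℝ)) := by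
  funext j
  rcases eq_or_ne j i with rfl | h
  · simp only [Rates.scale, Pi.add_apply, Pi.single_eq_same]; ring
  · simp [Rates.scale, h]

/-- The shift ϱⁿ/m in the scaling exists for this: the load terms cancel, and the sum is positive
exactly when jobs must wait. -/
theorem sum_scaledState (hm : m ≠ 0) (hn : 0 < n) (x : Fin m → ℕ) :
    ∑ i, r.scaledState n x i = ((∑ i, (x i : ℝ)) - n) / √(n : ℝ) := by
  have hn' : (0 : ℝ) < n := by exact_mod_cast hn
  have hs : 0 < √(n : ℝ) := Real.sqrt_pos.2 hn'
  have hs2 : √(n : ℝ) * √(n : ℝ) = n := Real.mul_self_sqrt hn'.le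
  have hm' : (m : ℝ) ≠ 0 := by exact_mod_cast hm
  simp only [Rates.scaledState, Rates.scale]
  rw [Finset.sum_sub_distrib, ← Finset.sum_div, Finset.sum_sub_distrib]
  simp only [Finset.sum_const, Finset.card_univ, Fintype.card_fin, nsmul_eq_mul]
  rw [mul_div_cancel₀ _ hm', Rates.spareCapacity]
  have h1 : ∑ i, r.lam i / (n * r.mu i) = (∑ i, r.lam i / r.mu i) / n := by
    rw [Finset.sum_div]
    exact Finset.sum_congr rfl fun i _ => by rw [div_div, mul_comm]
  rw [h1, eq_div_iff hs.ne', sub_mul, div_mul_cancel₀ _ hs.ne']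
  have h2 : √(n : ℝ) * (1 - (∑ i, r.lam i / r.mu i) / n) * √(n : ℝ) =
      (√(n : ℝ) * √(n : ℝ)) * (1 - (∑ i, r.lam i / r.mu i) / n) := by ring
  rw [h2, hs2]
  field_simp
  ring

theorem sum_queue_eq {x z : Fin m → ℕ} (hz : z ∈ allocations n x) :
    ∑ i, ((x i : ℝ) - z i) = max ((∑ i, (x i : ℝ)) - n) 0 := by
  have h := congrArg (fun k : ℕ => (k : ℝ)) hz.2
  push_cast at h
  rw [Finset.sum_sub_distrib, h]
  rcases le_total (n : ℝ) (∑ i, (x i : ℝ)) with h | h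
  · rw [min_eq_left h, max_eq_left (by linarith)]
  · rw [min_eq_right h, max_eq_right (by linarith)]; ring

/-- Controls the Lyapunov function on the bounded region where the drift may be positive. -/
theorem Rates.lyapunov_le {a η : ℝ} (ha : 0 < a) (hη : 0 < η) (hmu : ∀ i, a ≤ r.mu i)
    (h0 : 0 ≤ r.theta) (h1 : r.theta ≤ 1) (w : Fin m → ℝ) :
    r.lyapunov η w ≤ Real.exp (2 * (η / a) * l1norm w) := by
  rw [r.lyapunov_eq, l1norm, Finset.mul_sum]
  refine Real.exp_le_exp.2 (Finset.sum_le_sum fun i _ => ?_)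
  have hmi : 0 < r.mu i := ha.trans_le (hmu i)
  have h2 : psi (w i) + r.theta * psi (-w i) ≤ 2 * |w i| := by
    have h3 := psi_le_abs (w i)
    have h4 := psi_le_abs (-w i)
    rw [abs_neg] at h4
    nlinarith [mul_le_mul_of_nonneg_left h4 h0, abs_nonneg (w i)]
  calc _ ≤ η / r.mu i * (2 * |w i|) := by gcongr
    _ ≤ η / a * (2 * |w i|) := by gcongr; exact hmu i
    _ = _ := by ring

/-- Bounds on the rates of the `n`-server system that hold uniformly in `n` in the
Halfin--Whitt regime. -/
structure Rates.Bounded (r : Rates m) (n : ℕ) (a A : ℝ) : Prop where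
  le_mu : ∀ i, a ≤ r.mu i
  mu_le : ∀ i, r.mu i ≤ A
  le_gam : ∀ i, a ≤ r.gam i
  gam_le : ∀ i, r.gam i ≤ A
  lam_nonneg : ∀ i, 0 ≤ r.lam i
  lam_le : ∀ i, r.lam i ≤ A * n
  spareCapacity_le : |r.spareCapacity n| ≤ A

/-- M = max(1 − β_min, 1/2), and θ ≤ M/β_max is what gives −θ(1 − β_i) ≤ θ β_i ≤ M. The bounds a/A ≤
β_i ≤ A/a keep 1 − M and θ above a/(2A). -/
theorem Rates.Bounded.theta_spec [Nonempty (Fin m)] {a A : ℝ} (ha : 0 < a)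
    (h : r.Bounded n a A) :
    0 ≤ r.theta ∧ r.theta ≤ 1 ∧ a / (2 * A) ≤ r.theta ∧ ∃ M : ℝ, 0 ≤ M ∧
      a / (2 * A) ≤ 1 - M ∧ ∀ i, 1 - r.beta i ≤ M ∧ -(r.theta * (1 - r.beta i)) ≤ M := by
  have haA : a ≤ A := (h.le_mu (Classical.arbitrary _)).trans (h.mu_le _)
  have hA : 0 < A := ha.trans_le haA
  have hmu : ∀ i, 0 < r.mu i := fun i => ha.trans_le (h.le_mu i)
  have hb1 : ∀ i, a / A ≤ r.beta i := fun i =>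
    div_le_div₀ (ha.le.trans (h.le_gam i)) (h.le_gam i) (hmu i) (h.mu_le i)
  have hb2 : ∀ i, r.beta i ≤ A / a := fun i =>
    div_le_div₀ hA.le (h.gam_le i) ha (h.le_mu i)
  have hinf : a / A ≤ ⨅ i, r.beta i := le_ciInf hb1
  have hinf' : ∀ i, ⨅ i, r.beta i ≤ r.beta i := fun i => ciInf_le (Set.finite_range _).bddBelow i
  have hsup : ⨆ i, r.beta i ≤ A / a := ciSup_le hb2
  have hsup' : ∀ i, r.beta i ≤ ⨆ i, r.beta i := fun i => le_ciSup (Set.finite_range _).bddAbove i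
  have hsup0 : 0 < ⨆ i, r.beta i :=
    lt_of_lt_of_le (by positivity) ((hb1 (Classical.arbitrary _)).trans (hsup' _))
  set M := max (1 - ⨅ i, r.beta i) (1 / 2) with hM
  have hM2 : 1 / 2 ≤ M := le_max_right _ _
  have hθ : r.theta = min 1 (M / ⨆ i, r.beta i) := rfl
  have hκ : a / (2 * A) ≤ 1 / 2 := by
    rw [div_le_div_iff₀ (by positivity) (by norm_num)]; linarith
  have hκ' : a / (2 * A) ≤ a / A := by
    gcongr; linarith
  have h0 : 0 ≤ r.theta := by rw [hθ]; positivity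
  refine ⟨h0, ?_, ?_, M, by linarith, ?_, fun i => ⟨?_, ?_⟩⟩
  · rw [hθ]; exact min_le_left _ _
  · rw [hθ]
    refine le_min (by linarith) ?_
    rw [le_div_iff₀ hsup0]
    calc _ ≤ a / (2 * A) * (A / a) := by gcongr
      _ = 1 / 2 := by field_simp
      _ ≤ M := hM2
  · have : M ≤ 1 - a / (2 * A) := max_le (by linarith) (by linarith)
    linarith
  · exact le_trans (by linarith [hinf' i]) (le_max_left _ _)
  · have h2 : r.theta * r.beta i ≤ M := by
      calc _ ≤ r.theta * ⨆ i, r.beta i := by gcongr; exact hsup' i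
        _ ≤ M / (⨆ i, r.beta i) * ⨆ i, r.beta i := by
            gcongr; rw [hθ]; exact min_le_right _ _
        _ = M := div_mul_cancel₀ _ hsup0.ne'
    linarith

/-- The multiplicative drift inequality for the diffusion-scaled queue. -/
theorem Rates.Bounded.scaledGenerator_le [Nonempty (Fin m)] {a A η : ℝ} (ha : 0 < a)
    (hη : 0 < η) (h : r.Bounded n a A) (hn : 0 < n) (hε : 13 * (η / a) * (1 / √(n : ℝ)) ≤ 1)
    (hε' : (12 * (η / a) + 169 * (η / a) ^ 2) * A * (1 / √(n : ℝ)) ≤ η * (a / (2 * A)) / 2)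
    {x z : Fin m → ℕ} (hz : z ∈ allocations n x) :
    r.scaledGenerator n z (r.lyapunov η) x ≤ r.lyapunov η (r.scaledState n x) *
      (η * (m * (2 + A)) + 2 * (12 * (η / a) + 169 * (η / a) ^ 2) * A * m -
        η * (a / (2 * A)) / 2 * l1norm (r.scaledState n x)) := by
  obtain ⟨hθ0, hθ1, hκθ, M, hM0, hκM, hbM⟩ := h.theta_spec ha
  have hn' : (0 : ℝ) < n := by exact_mod_cast hn
  have hs : 0 < √(n : ℝ) := Real.sqrt_pos.2 hn'
  have hm0 : m ≠ 0 := by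
    rintro rfl; exact (Classical.arbitrary (Fin 0)).elim0
  have hm1 : (1 : ℝ) ≤ m := by exact_mod_cast Nat.one_le_iff_ne_zero.2 hm0
  have hmu : ∀ i, 0 < r.mu i := fun i => ha.trans_le (h.le_mu i)
  have hA : 0 < A := (hmu (Classical.arbitrary _)).trans_le (h.mu_le _)
  set ε : ℝ := 1 / √(n : ℝ) with hεdef
  have hε0 : 0 < ε := by positivity
  have hε1 : ε ≤ 1 := by
    rw [hεdef, div_le_one hs, Real.one_le_sqrt]; exact_mod_cast hn
  have hεn : ε ^ 2 * n = 1 := by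
    rw [hεdef, div_pow, Real.sq_sqrt hn'.le]; field_simp
  set B := 12 * (η / a) + 169 * (η / a) ^ 2 with hB
  have hB0 : 0 ≤ B := by positivity
  set y := r.scaledState n x with hy
  set v := r.lyapunov η y with hv
  have hv0 : 0 < v := Real.exp_pos _
  set e := r.spareCapacity n / m with he
  set q : Fin m → ℝ := fun i => ((x i : ℝ) - z i) * ε with hq
  have hxz : ∀ i, (z i : ℝ) ≤ x i := fun i => by exact_mod_cast hz.1 i
  have hq0 : ∀ i, 0 ≤ q i := fun i => mul_nonneg (sub_nonneg.2 (hxz i)) hε0.le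
  have hqy : ∑ i, q i = max (∑ i, y i) 0 := by
    rw [hy, sum_scaledState hm0 hn, hq, ← Finset.sum_mul, sum_queue_eq hz, hεdef,
      max_mul_of_nonneg _ _ hε0.le, zero_mul, mul_one_div]
  have hd0 : ∀ i, 0 ≤ r.departureRate x z i := fun i =>
    le_trans (by positivity) (Rates.mul_le_departureRate h.le_mu h.le_gam hz.1 i)
  set s : Fin m → ℝ := fun i => η / r.mu i * slope r.theta (y i) with hsdef
  have hstep : ∀ i (δ : ℝ), |δ| ≤ ε →
      r.lyapunov η (y + Pi.single i δ) - v ≤ v * (δ * s i + B * δ ^ 2) := by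
    intro i δ hδ
    rw [r.lyapunov_add_single, ← hv]
    have h1 := exp_sub_one_le (t := y i) (δ := δ) (c := η / r.mu i) (C := η / a) hθ0 hθ1
      (div_nonneg hη.le (hmu i).le) (div_le_div_of_nonneg_left hη.le ha (h.le_mu i))
      (hδ.trans hε1) (le_trans (by gcongr) hε)
    have h2 := mul_le_mul_of_nonneg_left h1 hv0.le
    linarith
  have hup : ∀ i, r.lyapunov η (r.scale n ((fun j => (x j : ℝ)) + Pi.single i 1)) -
      r.lyapunov η (r.scale n fun j => (x j : ℝ)) ≤ v * (ε * s i + B * ε ^ 2) := fun i => by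
    rw [r.scale_add_single, ← hεdef]
    exact hstep i ε (abs_of_pos hε0).le
  have hdown : ∀ i, r.lyapunov η (r.scale n ((fun j => (x j : ℝ)) - Pi.single i 1)) -
      r.lyapunov η (r.scale n fun j => (x j : ℝ)) ≤ v * (-ε * s i + B * ε ^ 2) := fun i => by
    have hneg : (fun j => (x j : ℝ)) - Pi.single i 1 = (fun j => (x j : ℝ)) + Pi.single i (-1) := by
      rw [Pi.single_neg, sub_eq_add_neg]
    rw [hneg, r.scale_add_single, neg_div, ← hεdef]
    have := hstep i (-ε) (by rw [abs_neg, abs_of_pos hε0])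
    rwa [neg_sq] at this
  -- Departures equal μ_i x_i − (μ_i − γ_i)(x_i − z_i); the weight η/μ_i cancels μ_i, leaving the
  -- centred state and the queue.
  have hfirst : ∀ i, (r.lam i - r.departureRate x z i) * (ε * s i) =
      η * (slope r.theta (y i) * (-(y i + e) + (1 - r.beta i) * q i)) := by
    intro i
    have hmi := (hmu i).ne'
    have hye : y i + e = ((x i : ℝ) - r.lam i / r.mu i) * ε := by
      rw [hy, he, hεdef]; simp only [Rates.scaledState, Rates.scale]; ring
    rw [hye]
    simp only [hsdef, hq, Rates.departureRate, Rates.beta]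
    field_simp
    ring
  -- Since ε² n = 1, arrivals and services contribute O(1); only abandonment grows with the state,
  -- with a spare factor ε.
  have hsecond : ∀ i, B * ε ^ 2 * (r.lam i + r.departureRate x z i) ≤
      B * (2 * A) + B * A * ε * q i := by
    intro i
    have hzn : (z i : ℝ) ≤ n := by
      have h1 : z i ≤ ∑ j, z j := Finset.single_le_sum (fun _ _ => Nat.zero_le _)
        (Finset.mem_univ i)
      have h2 : ∑ j, z j ≤ n := hz.2.le.trans (min_le_left _ _)
      exact_mod_cast h1.trans h2
    have h1 : ε ^ 2 * r.lam i ≤ A := by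
      calc _ ≤ ε ^ 2 * (A * n) := by gcongr; exact h.lam_le i
        _ = A * (ε ^ 2 * n) := by ring
        _ = A := by rw [hεn, mul_one]
    have h2 : ε ^ 2 * (r.mu i * z i) ≤ A := by
      calc _ ≤ ε ^ 2 * (A * n) := by
            gcongr
            exact h.mu_le i
        _ = A * (ε ^ 2 * n) := by ring
        _ = A := by rw [hεn, mul_one]
    have h3 : ε ^ 2 * (r.gam i * ((x i : ℝ) - z i)) ≤ A * ε * q i := by
      calc _ ≤ ε ^ 2 * (A * ((x i : ℝ) - z i)) := by
            gcongr
            · exact sub_nonneg.2 (hxz i)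
            · exact h.gam_le i
        _ = _ := by simp only [hq]; ring
    have h4 : ε ^ 2 * (r.lam i + r.departureRate x z i) ≤ 2 * A + A * ε * q i := by
      rw [Rates.departureRate]; linarith
    have h5 := mul_le_mul_of_nonneg_left h4 hB0
    linarith
  have hqnorm : ∑ i, q i ≤ l1norm y := by
    rw [hqy, l1norm]
    exact max_le (Finset.sum_le_sum fun i _ => le_abs_self _)
      (Finset.sum_nonneg fun i _ => abs_nonneg _)
  have hmain := sum_slope_mul_le (y := y) (q := q) (b := fun i => 1 - r.beta i) (A := A) (e := e)
    hθ0 hθ1 hq0 hqy hM0 (fun i => (hbM i).1) (fun i => (hbM i).2) hκM hκθ (by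
      rw [he, abs_div, Nat.abs_cast]
      exact (div_le_self (abs_nonneg _) hm1).trans h.spareCapacity_le)
  calc r.scaledGenerator n z (r.lyapunov η) x
      ≤ ∑ i, r.lam i * (v * (ε * s i + B * ε ^ 2)) +
        ∑ i, r.departureRate x z i * (v * (-ε * s i + B * ε ^ 2)) := by
        rw [Rates.scaledGenerator, Rates.generator]
        exact add_le_add
          (Finset.sum_le_sum fun i _ => mul_le_mul_of_nonneg_left (hup i) (h.lam_nonneg i))
          (Finset.sum_le_sum fun i _ => mul_le_mul_of_nonneg_left (hdown i) (hd0 i))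
    _ = v * (∑ i, (r.lam i - r.departureRate x z i) * (ε * s i) +
        ∑ i, B * ε ^ 2 * (r.lam i + r.departureRate x z i)) := by
        rw [← Finset.sum_add_distrib, ← Finset.sum_add_distrib, Finset.mul_sum]
        exact Finset.sum_congr rfl fun i _ => by ring
    _ ≤ v * (η * (m * (2 + A) - a / (2 * A) * ∑ i, |y i|) +
        (m * (B * (2 * A)) + B * A * ε * l1norm y)) := by
        gcongr
        · rw [Finset.sum_congr rfl fun i _ => hfirst i, ← Finset.mul_sum]
          gcongr
        · refine (Finset.sum_le_sum fun i _ => hsecond i).trans ?_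
          rw [Finset.sum_add_distrib]
          simp only [Finset.sum_const, Finset.card_univ, Fintype.card_fin, nsmul_eq_mul]
          refine add_le_add le_rfl ?_
          rw [← Finset.mul_sum]
          gcongr
    -- By `hε'`, half of the negative drift pays for the growing second-order term.
    _ ≤ _ := by
        gcongr
        have h1 : 0 ≤ l1norm y := Finset.sum_nonneg fun i _ => abs_nonneg _
        have h2 := mul_le_mul_of_nonneg_right hε' h1
        have h3 : ∑ i, |y i| = l1norm y := rfl
        rw [h3]
        linarith

/-- Absorbs the region where a multiplicative drift is positive into an additive constant. -/
theorem mul_sub_le_of_le_exp {v l C k D : ℝ} (hv0 : 0 ≤ v) (hl : 0 ≤ l) (hC : 0 ≤ C) (hk : 0 < k)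
    (hD : 0 ≤ D) (hv : v ≤ Real.exp (D * l)) :
    v * (C - 2 * k * l) ≤ C * Real.exp (D * (C / k)) - k * l * v := by
  have h1 : v * (C - k * l) ≤ C * Real.exp (D * (C / k)) := by
    rcases le_total l (C / k) with h | h
    · calc v * (C - k * l) ≤ v * C := by
            gcongr
            linarith [mul_nonneg hk.le hl]
        _ ≤ Real.exp (D * l) * C := by gcongr
        _ ≤ C * Real.exp (D * (C / k)) := by rw [mul_comm]; gcongr
    · rw [div_le_iff₀ hk] at h
      have : v * (C - k * l) ≤ 0 := mul_nonpos_of_nonneg_of_nonpos hv0 (by linarith)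
      exact this.trans (by positivity)
  linarith

end Drift

/-! ### Uniform bounds in the Halfin–Whitt regime -/

section Regime

variable {m : ℕ} {r : ℕ → Rates m} {lam mu gam lamHat muHat : Fin m → ℝ}

theorem HalfinWhitt.nonempty (h : HalfinWhitt r lam mu gam lamHat muHat) : Nonempty (Fin m) := by
  rcases isEmpty_or_nonempty (Fin m) with hm | hm
  · have := h.sum_load
    simp at this
  · exact hm

/-- Writing 1 as Σ λ_i/μ_i turns the spare capacity into √n Σ (λ_i/μ_i − λ_iⁿ/(nμ_iⁿ)), governed by
the second-order limits. Only boundedness is needed later. -/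
theorem HalfinWhitt.tendsto_spareCapacity (h : HalfinWhitt r lam mu gam lamHat muHat) :
    Tendsto (fun n => (r n).spareCapacity n) atTop
      (𝓝 (∑ i, (lam i * muHat i - lamHat i * mu i) / (mu i * mu i))) := by
  have hterm : ∀ i, Tendsto (fun n : ℕ => (lam i * (√(n : ℝ) * ((r n).mu i - mu i)) -
      ((r n).lam i - n * lam i) / √(n : ℝ) * mu i) / (mu i * (r n).mu i)) atTop
      (𝓝 ((lam i * muHat i - lamHat i * mu i) / (mu i * mu i))) := fun i =>
    ((((h.tendsto_muHat i).const_mul _).sub ((h.tendsto_lamHat i).mul_const _))).div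
      ((h.tendsto_mu i).const_mul _) (mul_pos (h.mu_pos i) (h.mu_pos i)).ne'
  refine (tendsto_finsetSum Finset.univ fun i _ => hterm i).congr' ?_
  have hmu : ∀ᶠ n in atTop, ∀ i, 0 < (r n).mu i :=
    eventually_all.2 fun i => (h.tendsto_mu i).eventually_const_lt (h.mu_pos i)
  filter_upwards [hmu, eventually_gt_atTop 0] with n hn hn0
  have hn' : (0 : ℝ) < n := by exact_mod_cast hn0
  have hs : 0 < √(n : ℝ) := Real.sqrt_pos.2 hn'
  have hs2 : √(n : ℝ) ^ 2 = n := Real.sq_sqrt hn'.le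
  rw [Rates.spareCapacity, ← h.sum_load, ← Finset.sum_sub_distrib, Finset.mul_sum]
  refine Finset.sum_congr rfl fun i _ => ?_
  have h1 := (hn i).ne'
  have h2 := (h.mu_pos i).ne'
  have h3 : ((r n).lam i - n * lam i) / √(n : ℝ) = √(n : ℝ) * ((r n).lam i / n - lam i) := by
    rw [div_eq_iff hs.ne']
    calc _ = (n : ℝ) * ((r n).lam i / n - lam i) := by field_simp
      _ = √(n : ℝ) ^ 2 * ((r n).lam i / n - lam i) := by rw [hs2]
      _ = _ := by ring
  rw [h3]
  field_simp
  ring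

theorem HalfinWhitt.exists_bounded (h : HalfinWhitt r lam mu gam lamHat muHat)
    (hgam : ∀ i, 0 < liminf (fun n => (r n).gam i) atTop) :
    ∃ a A : ℝ, 0 < a ∧ 0 < A ∧
      ∀ᶠ n : ℕ in atTop, (r n).Bounded n a A ∧ ∀ i, 0 < (r n).lam i := by
  have := h.nonempty
  have hgam' : ∀ i, 0 < gam i := fun i => (h.tendsto_gam i).liminf_eq ▸ hgam i
  obtain ⟨i₀, hi₀⟩ := Finite.exists_min fun i => min (mu i) (gam i)
  obtain ⟨i₁, hi₁⟩ := Finite.exists_max fun i => mu i + gam i + lam i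
  have hρ := h.tendsto_spareCapacity.abs
  set ρ := |∑ i, (lam i * muHat i - lamHat i * mu i) / (mu i * mu i)|
  have hρ0 : 0 ≤ ρ := abs_nonneg _
  -- Half the least limit of the service and abandonment rates, and a strict upper bound for all the
  -- limits involved, so convergence gives the bounds eventually.
  obtain ⟨a, ha⟩ : ∃ a, a = min (mu i₀) (gam i₀) / 2 := ⟨_, rfl⟩
  obtain ⟨A, hA⟩ : ∃ A, A = mu i₁ + gam i₁ + lam i₁ + ρ + 1 := ⟨_, rfl⟩
  have ha0 : 0 < a := by
    have := lt_min (h.mu_pos i₀) (hgam' i₀)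
    linarith
  have hpos := fun i => (⟨h.mu_pos i, hgam' i, h.lam_pos i⟩ : 0 < mu i ∧ 0 < gam i ∧ 0 < lam i)
  have hmua : ∀ i, a < mu i := fun i => by
    linarith [(hi₀ i).trans (min_le_left _ _), hpos i]
  have hgama : ∀ i, a < gam i := fun i => by
    linarith [(hi₀ i).trans (min_le_right _ _), hpos i]
  have hsum : ∀ i, mu i < A ∧ gam i < A ∧ lam i < A := fun i => by
    obtain ⟨h1, h2, h3⟩ := hpos i
    have := hi₁ i
    refine ⟨?_, ?_, ?_⟩ <;> linarith
  have hρA : ρ < A := by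
    obtain ⟨h1, h2, h3⟩ := hpos i₁
    linarith
  refine ⟨a, A, ha0, hρ0.trans_lt hρA, ?_⟩
  have hev : ∀ᶠ n : ℕ in atTop, ∀ i, a < (r n).mu i ∧ (r n).mu i < A ∧ a < (r n).gam i ∧
      (r n).gam i < A ∧ 0 < (r n).lam i / n ∧ (r n).lam i / n < A :=
    eventually_all.2 fun i =>
      ((h.tendsto_mu i).eventually_const_lt (hmua i)).and <|
      ((h.tendsto_mu i).eventually_lt_const (hsum i).1).and <|
      ((h.tendsto_gam i).eventually_const_lt (hgama i)).and <|
      ((h.tendsto_gam i).eventually_lt_const (hsum i).2.1).and <|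
      ((h.tendsto_lam i).eventually_const_lt (h.lam_pos i)).and <|
      (h.tendsto_lam i).eventually_lt_const (hsum i).2.2
  filter_upwards [hev, hρ.eventually_lt_const hρA, eventually_gt_atTop 0] with n hn hn' hn0
  have hn0' : (0 : ℝ) < n := by exact_mod_cast hn0
  have hlam : ∀ i, 0 < (r n).lam i := fun i => by
    obtain ⟨-, -, -, -, h5, -⟩ := hn i
    exact (div_pos_iff_of_pos_right hn0').1 h5
  refine ⟨⟨fun i => (hn i).1.le, fun i => (hn i).2.1.le, fun i => (hn i).2.2.1.le,
    fun i => (hn i).2.2.2.1.le, fun i => (hlam i).le, fun i => ?_, hn'.le⟩, hlam⟩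
  exact ((div_lt_iff₀ hn0').1 (hn i).2.2.2.2.2).le

end Regime

end ManyServer

theorem theorem3p4 {m : ℕ} (r : ℕ → ManyServer.Rates m)
    (lam mu gam lamHat muHat : Fin m → ℝ)
    (hHW : ManyServer.HalfinWhitt r lam mu gam lamHat muHat)
    (hgam : ∀ i, 0 < liminf (fun n => (r n).gam i) atTop) :
    (∀ η : ℝ, 0 < η → ∃ κ₀ κ₁ : ℝ, 0 < κ₀ ∧ 0 < κ₁ ∧
      ∀ᶠ n : ℕ in atTop, ∀ x : Fin m → ℕ, ∀ z ∈ ManyServer.allocations n x,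
        (r n).scaledGenerator n z ((r n).lyapunov η) x ≤
          κ₀ - κ₁ * ManyServer.l1norm ((r n).scaledState n x) *
            (r n).lyapunov η ((r n).scaledState n x)) ∧
    (∀ᶠ n : ℕ in atTop, ∀ z : (Fin m → ℕ) → (Fin m → ℕ),
      ManyServer.IsWorkConservingPolicy n z →
        (∃! π : Measure (Fin m → ℕ),
          ManyServer.IsStationaryDistribution ((r n).jumpRate z) π) ∧
        ∀ π : Measure (Fin m → ℕ),
          ManyServer.IsStationaryDistribution ((r n).jumpRate z) π →
            ∀ η : ℝ, 0 < η →
              Integrable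
                (fun x => Real.exp (η * ManyServer.l1norm ((r n).scaledState n x))) π) := by
  have hm := hHW.nonempty
  have hm0 : 0 < (m : ℝ) := by exact_mod_cast (Classical.arbitrary (Fin m)).pos
  obtain ⟨a, A, ha, hA, hev⟩ := hHW.exists_bounded hgam
  have hsqrt : Tendsto (fun n : ℕ => 1 / √(n : ℝ)) atTop (𝓝 0) := by
    simp_rw [one_div]
    exact tendsto_inv_atTop_zero.comp (Real.tendsto_sqrt_atTop.comp tendsto_natCast_atTop_atTop)
  constructor
  · intro η hη
    have hB : 0 < 12 * (η / a) + 169 * (η / a) ^ 2 := by positivity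
    have hC : 0 < η * (m * (2 + A)) + 2 * (12 * (η / a) + 169 * (η / a) ^ 2) * A * m := by
      positivity
    -- A quarter, since `scaledGenerator_le` leaves the rate 2k: one k dominates the constant far
    -- out, the other is κ₁.
    have hk : 0 < η * (a / (2 * A)) / 4 := by positivity
    have h1 := (hsqrt.const_mul (13 * (η / a))).eventually_lt_const (u := 1) (by simp)
    have h2 := (hsqrt.const_mul ((12 * (η / a) + 169 * (η / a) ^ 2) * A)).eventually_lt_const
      (u := η * (a / (2 * A)) / 2) (by rw [mul_zero]; positivity)
    refine ⟨_, _, mul_pos hC (Real.exp_pos (2 * (η / a) * ((η * (m * (2 + A)) +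
      2 * (12 * (η / a) + 169 * (η / a) ^ 2) * A * m) / (η * (a / (2 * A)) / 4)))), hk, ?_⟩
    filter_upwards [hev, h1, h2, eventually_gt_atTop 0] with n hn h1 h2 hn0 x z hz
    have h3 := hn.1.scaledGenerator_le ha hη hn0 h1.le h2.le hz
    obtain ⟨hθ0, hθ1, -⟩ := hn.1.theta_spec ha
    refine h3.trans (le_trans (le_of_eq ?_) (ManyServer.mul_sub_le_of_le_exp (Real.exp_pos _).le
      (Finset.sum_nonneg fun i _ => abs_nonneg _) hC.le hk (by positivity)
      (ManyServer.Rates.lyapunov_le ha hη hn.1.le_mu hθ0 hθ1 _)))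
    ring
  · filter_upwards [hev, eventually_gt_atTop 0] with n hn hn0 z hz
    exact ManyServer.existsUnique_isStationaryDistribution_and_integrable hn0 hn.2 ha hn.1.le_mu
      hn.1.le_gam hz
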